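/- Let $\mathbb K\in\{\mathbb R,\mathbb C\}$, let $\mathbb T=\{\theta\in\mathbb K:|\theta|=1\}$, and let $X$, $Y$ be Banach spaces over $\mathbb K$. $B_Z$ denotes the closed unit ball of $Z$, $Z^*$ the dual, and $\mathcal L(X,Y)$ the bounded linear operators from $X$ to $Y$ with the operator norm. Definitions. A functional $f\in Z^*$ strongly exposes a bounded set $C\subseteq Z$ at $z_0\in C$ if $\operatorname{Re} f(z_0)=\sup_{C}\operatorname{Re} f$ and every sequence $(z_n)$ in $C$ with $\operatorname{Re} f(z_n)\to\operatorname{Re} f(z_0)$ converges in norm to $z_0$; such $z_0$ are the strongly exposed points of $C$. $\operatorname{SE}(X)$ is the set of functionals in $X^*$ that strongly expose $B_X$ at some point. A $w^*$-strongly exposed point of $B_{Y^*}$ is a point strongly exposed in $B_{Y^*}$ by evaluation at some element of $Y$. $Y^*$ has the Radon--Nikodým property (RNP) if every nonempty bounded subset $C$ of $Y^*$ is dentable, i.e. has slices $\{z\in C:\operatorname{Re} f(z)>\sup_C\operatorname{Re} f-\alpha\}$ ($f\in Y^{**}$, $\alpha>0$) of arbitrarily small diameter. $\operatorname{NA}(X,Y)$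 is the set of $T\in\mathcal L(X,Y)$ with $\|T\|=\|Tx\|$ for some $x\in X$, $\|x\|=1$. $\operatorname{ASE}(X,Y)$ is the set of $T\in\mathcal L(X,Y)$ for which there is $x_0\in B_X$ such that, whenever $(x_n)$ in $B_X$ satisfies $\|Tx_n\|\to\|T\|$, there are $\theta_n\in\mathbb T$ with $\theta_nx_n\to x_0$. A set is residual if it contains a countable intersection of dense open sets. Theorem. Suppose that $Y^*$ has the RNP and that for every sequence $(y_n^*)$ of $w^*$-strongly exposed points of $B_{Y^*}$ which converges in norm to a strongly exposed point $y_0^*$ of $B_{Y^*}$ there are $n_0\in\mathbb N$ and $(\theta_n)$ in $\mathbb T$ with $y_n^*=\theta_ny_0^*$ for all $n\ge n_0$. Let $\mathcal I(X,Y)$ be a closed linear subspace of $\mathcal L(X,Y)$ containing all the operators $x\mapsto x^*(x)y$ with $x^*\in X^*$ and $y\in Y$. (a) If $\operatorname{NA}(X,\mathbb K)$ is residual in $X^*$, then $\operatorname{NA}(X,Y)\cap\mathcal I(X,Y)$ is residual in $\mathcal I(X,Y)$. (b) If $\operatorname{SE}(X)$ is dense in $X^*$, then the elements of $\mathcal I(X,Y)$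 at which the norm of $\mathcal L(X,Y)$ is Fréchet differentiable are dense in $\mathcal I(X,Y)$. If moreover $Y\neq\{0\}$, then $\operatorname{ASE}(X,Y)\cap\mathcal I(X,Y)$ is dense in $\mathcal I(X,Y)$. Both assumptions on $Y$ are satisfied whenever $Y$ is an isometric predual of $\ell_1(\Gamma)$ for some set $\Gamma$, that is, whenever $Y^*$ is isometrically isomorphic to $\ell_1(\Gamma)$ (so (a) and (b) hold for such $Y$). -/

import Mathlib

open Filter Topology

namespace NormAttaining

section Exposed

variable (𝕜 : Type*) [RCLike 𝕜] {E : Type*} [NormedAddCommGroup E] [NormedSpace 𝕜 E]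

/-- The functional `f` strongly exposes the point `x₀` of the set `C`: `Re f` attains its supremum
over `C` at `x₀`, and every maximizing sequence of `Re f` in `C` converges in norm to `x₀`. -/
def StronglyExposes (f : StrongDual 𝕜 E) (C : Set E) (x₀ : E) : Prop :=
  x₀ ∈ C ∧ (∀ x ∈ C, RCLike.re (f x) ≤ RCLike.re (f x₀)) ∧
    ∀ u : ℕ → E, (∀ n, u n ∈ C) →
      Tendsto (fun n => RCLike.re (f (u n))) atTop (𝓝 (RCLike.re (f x₀))) →
      Tendsto u atTop (𝓝 x₀)

/-- The strongly exposed points of `C`. -/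
def strExp (C : Set E) : Set E :=
  {x₀ | ∃ f : StrongDual 𝕜 E, StronglyExposes 𝕜 f C x₀}

variable (E) in
/-- `SE(E)`: the functionals which strongly expose the closed unit ball of `E` at some point. -/
def SE : Set (StrongDual 𝕜 E) :=
  {f | ∃ x₀ : E, StronglyExposes 𝕜 f (Metric.closedBall (0 : E) 1) x₀}

/-- The `w*`-strongly exposed points of a subset `C` of the dual space `E*`: those strongly exposed
by (evaluation at) an element of `E`, seen in the bidual. -/
def wStarStrExp (C : Set (StrongDual 𝕜 E)) : Set (StrongDual 𝕜 E) :=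
  {f₀ | ∃ x : E, StronglyExposes 𝕜 (NormedSpace.inclusionInDoubleDual 𝕜 E x) C f₀}

/-- The slice `{x ∈ C : Re f x > sup_C Re f - α}`. -/
def slice (C : Set E) (f : StrongDual 𝕜 E) (α : ℝ) : Set E :=
  {x ∈ C | sSup ((fun z => RCLike.re (f z)) '' C) - α < RCLike.re (f x)}

/-- `C` is dentable: it has slices of arbitrarily small diameter. -/
def Dentable (C : Set E) : Prop :=
  ∀ ε : ℝ, 0 < ε → ∃ (f : StrongDual 𝕜 E) (α : ℝ), 0 < α ∧ Metric.diam (slice 𝕜 C f α) < ε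

variable (E) in
/-- The Radon-Nikodym property of a Banach space, in its geometric form:
every nonempty bounded subset is dentable. -/
def HasRNP : Prop :=
  ∀ C : Set E, C.Nonempty → Bornology.IsBounded C → Dentable 𝕜 C

/-- The norm of `E` is Fréchet differentiable at `x` (`E` regarded as a real normed space). -/
def NormFrechetDifferentiableAt (x : E) : Prop :=
  letI : NormedSpace ℝ E := NormedSpace.restrictScalars ℝ 𝕜 E
  DifferentiableAt ℝ (fun z : E => ‖z‖) x

end Exposed

section Operators

variable (𝕜 : Type*) [RCLike 𝕜]
  (X : Type*) [NormedAddCommGroup X] [NormedSpace 𝕜 X]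
  (Y : Type*) [NormedAddCommGroup Y] [NormedSpace 𝕜 Y]

/-- The set `NA(X, Y)` of norm attaining operators. -/
def NA : Set (X →L[𝕜] Y) :=
  {T | ∃ x : X, ‖x‖ = 1 ∧ ‖T x‖ = ‖T‖}

/-- The set `ASE(X, Y)` of absolutely strongly exposing operators: for some `x₀` in the unit ball,
every sequence of the unit ball which is maximizing for `‖T ·‖` converges to `x₀` up to
rotations. -/
def ASE : Set (X →L[𝕜] Y) :=
  {T | ∃ x₀ ∈ Metric.closedBall (0 : X) 1, ∀ u : ℕ → X,
    (∀ n, u n ∈ Metric.closedBall (0 : X) 1) →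
    Tendsto (fun n => ‖T (u n)‖) atTop (𝓝 ‖T‖) →
    ∃ θ : ℕ → 𝕜, (∀ n, ‖θ n‖ = 1) ∧ Tendsto (fun n => θ n • u n) atTop (𝓝 x₀)}

/-- Every sequence of `w*`-strongly exposed points of the unit ball of `Y*` which converges in norm
to a strongly exposed point `y₀` is eventually made of rotations of `y₀`. -/
def DualDiscreteUpToRotations : Prop :=
  ∀ (u : ℕ → StrongDual 𝕜 Y) (y₀ : StrongDual 𝕜 Y),
    (∀ n, u n ∈ wStarStrExp 𝕜 (Metric.closedBall (0 : StrongDual 𝕜 Y) 1)) →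
    y₀ ∈ strExp 𝕜 (Metric.closedBall (0 : StrongDual 𝕜 Y) 1) →
    Tendsto u atTop (𝓝 y₀) →
    ∃ (n₀ : ℕ) (θ : ℕ → 𝕜), (∀ n, ‖θ n‖ = 1) ∧ ∀ n ≥ n₀, u n = θ n • y₀

end Operators

end NormAttaining

namespace NormAttaining

/-! ### Dense Šmulyan points of `y ↦ ‖a + j y‖` from the RNP of `Y*`. -/

section NearSupport

variable {𝕜 : Type*} [RCLike 𝕜] {Z : Type*} [NormedAddCommGroup Z] [NormedSpace 𝕜 Z]
  {Y : Type*} [NormedAddCommGroup Y] [NormedSpace 𝕜 Y]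

/-! A generic operator has a norm governed by a single functional. `IsolatesNorm T f₀` says that, up
to rotations, `f₀` is the only `w*`-strongly exposed functional for which `‖f ∘ T‖` comes close to
`‖T‖`. Under the RNP these functionals are norming, so `‖S‖ = ‖f₀ ∘ S‖` for every `S` near `T`. Norm
attainment, Fréchet differentiability and absolute strong exposure of `T` thereby reduce to
properties of `f₀ ∘ T ∈ X*`, and `f₀ ∘ T` can be moved to any nearby functional by a rank-one
perturbation.

Isolation is an open condition; its density is the main point (`exists_isolatesNorm`). By the RNP,
`y ↦ ‖T + φ ⊗ y‖` passes Šmulyan's test at a dense set of `y` (`dense_smulyan`): otherwise nearly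
supporting functionals split again and again, giving a bounded separated dyadic tree in `Y*`. If `φ`
stays away from zero where `S = T + φ ⊗ y` nearly attains its norm, the test makes every sequence
maximizing `‖f ∘ S‖` in the dual ball converge, up to rotations, to one `f₀`, and the discreteness
assumption upgrades convergence to isolation.

For preduals of `ℓ₁(Γ)`, strongly exposed points of the dual ball correspond to rotated unit
vectors, and dentability follows by maximizing a linear form plus a small quadratic one
(`hasRNP_lp_one`). -/

lemma re_apply_le (f : StrongDual 𝕜 Z) (z : Z) : RCLike.re (f z) ≤ ‖f‖ * ‖z‖ :=
  (RCLike.re_le_norm _).trans (f.le_opNorm z)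

lemma re_apply_le_norm {f : StrongDual 𝕜 Z} (hf : ‖f‖ ≤ 1) (z : Z) : RCLike.re (f z) ≤ ‖z‖ :=
  (re_apply_le f z).trans (mul_le_of_le_one_left (norm_nonneg _) hf)

lemma re_apply_le_norm_of_ball (f : StrongDual 𝕜 Z) {z : Z} (hz : ‖z‖ ≤ 1) :
    RCLike.re (f z) ≤ ‖f‖ :=
  (re_apply_le f z).trans (mul_le_of_le_one_right (norm_nonneg _) hz)

lemma exists_unit_mul_eq_norm (c : 𝕜) : ∃ θ : 𝕜, ‖θ‖ = 1 ∧ θ * c = (‖c‖ : 𝕜) := by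
  obtain ⟨θ, h, h'⟩ := RCLike.exists_norm_eq_mul_self c
  exact ⟨θ, h, h'.symm⟩

variable (𝕜) in
/-- The functionals of the dual unit ball which nearly attain their norm at `S`. -/
def nearSupport (S : Z) (δ : ℝ) : Set (StrongDual 𝕜 Z) :=
  {Φ | ‖Φ‖ ≤ 1 ∧ ‖S‖ - δ < RCLike.re (Φ S)}

lemma nearSupport_nonempty (S : Z) {δ : ℝ} (hδ : 0 < δ) : (nearSupport 𝕜 S δ).Nonempty := by
  obtain ⟨g, hg, h⟩ := exists_dual_vector'' 𝕜 S
  exact ⟨g, hg, by rw [h, RCLike.ofReal_re]; linarith⟩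

/-- The factor 2 pays once for the change of `‖S‖` and once for the change of `Re Φ(S)`. -/
lemma nearSupport_subset {S S' : Z} {δ δ' : ℝ} (h : 2 * ‖S - S'‖ + δ' ≤ δ) :
    nearSupport 𝕜 S' δ' ⊆ nearSupport 𝕜 S δ := by
  rintro Φ ⟨hΦ, h1⟩
  refine ⟨hΦ, ?_⟩
  have h2 := re_apply_le_norm hΦ (S' - S)
  rw [map_sub, map_sub, norm_sub_rev] at h2
  have h3 := norm_sub_norm_le S S'
  linarith

lemma half_add_mem_nearSupport {S : Z} {δ : ℝ} {Φ Ψ : StrongDual 𝕜 Z}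
    (hΦ : Φ ∈ nearSupport 𝕜 S δ) (hΨ : Ψ ∈ nearSupport 𝕜 S δ) :
    (2⁻¹ : 𝕜) • (Φ + Ψ) ∈ nearSupport 𝕜 S δ := by
  have h2 : ((2 : 𝕜)⁻¹) = (((2 : ℝ)⁻¹ : ℝ) : 𝕜) := by push_cast; rfl
  constructor
  · rw [norm_smul, h2, RCLike.norm_ofReal, abs_of_pos (by norm_num)]
    have := norm_add_le Φ Ψ
    linarith [hΦ.1, hΨ.1]
  · rw [FunLike.coe_smul, Pi.smul_apply, smul_eq_mul, h2, RCLike.re_ofReal_mul,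
      FunLike.coe_add, Pi.add_apply, map_add]
    linarith [hΦ.2, hΨ.2]

/-- Approximate monotonicity of the subdifferential of the norm: test `Φ` at `S + t v`, test `Ψ` at
`S`, and add. -/
lemma re_apply_of_mem_nearSupport_add {S v : Z} {δ δ' t : ℝ}
    {Φ Ψ : StrongDual 𝕜 Z} (hΦ : Φ ∈ nearSupport 𝕜 S δ)
    (hΨ : Ψ ∈ nearSupport 𝕜 (S + (t : 𝕜) • v) δ') :
    t * RCLike.re (Φ v) - (δ + δ') ≤ t * RCLike.re (Ψ v) := by
  have h1 := hΨ.2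
  have h2 := re_apply_le_norm hΦ.1 (S + (t : 𝕜) • v)
  have h3 := re_apply_le_norm hΨ.1 S
  simp only [map_add, map_smul, smul_eq_mul, RCLike.re_ofReal_mul] at h1 h2
  linarith [hΦ.2]

lemma exists_re_apply_gt {f : StrongDual 𝕜 Y} {ε : ℝ} (h : ε < ‖f‖) :
    ∃ y : Y, ‖y‖ ≤ 1 ∧ ε < RCLike.re (f y) := by
  obtain ⟨y, hy, h1⟩ := f.exists_lt_apply_of_lt_opNorm h
  obtain ⟨θ, hθ, h2⟩ := exists_unit_mul_eq_norm (f y)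
  refine ⟨θ • y, by rw [norm_smul, hθ, one_mul]; exact hy.le, ?_⟩
  rw [map_smul, smul_eq_mul, h2, RCLike.ofReal_re]
  exact h1

/-- Two disjoint halves, separated by a vector of the unit ball of `Y`, of the functionals nearly
supporting `a + j y`, provided these are spread out near `y`. -/
lemma exists_separated_nearSupport (j : Y →L[𝕜] Z) (a : Z) {c : Y} {ρ ε : ℝ} (hε : 0 < ε)
    (hbad : ∀ y ∈ Metric.ball c ρ, ∀ δ > 0, ∃ Φ ∈ nearSupport 𝕜 (a + j y) δ,
      ∃ Ψ ∈ nearSupport 𝕜 (a + j y) δ, ε < ‖(Φ - Ψ).comp j‖)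
    {y : Y} (hy : y ∈ Metric.ball c ρ) {r : ℝ} (hr : 0 < r) :
    ∃ (h : Y) (p : Bool → Y × ℝ), ‖h‖ ≤ 1 ∧
      (∀ b, (p b).1 ∈ Metric.ball c ρ ∧ 0 < (p b).2 ∧
        nearSupport 𝕜 (a + j (p b).1) (p b).2 ⊆ nearSupport 𝕜 (a + j y) r) ∧
      ∀ Φ ∈ nearSupport 𝕜 (a + j (p true).1) (p true).2,
        ∀ Ψ ∈ nearSupport 𝕜 (a + j (p false).1) (p false).2,
          ε / 2 ≤ RCLike.re ((Φ - Ψ) (j h)) := by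
  -- The base point moves to `y ± t h`. The choice of `M` gives `2 t ‖j‖ + t ε / 8 ≤ r`, which is
  -- what nesting requires.
  have hyρ : 0 < ρ - dist y c := sub_pos.2 hy
  set M := 2 * ‖j‖ + ε / 8 with hM
  have hMpos : 0 < M := by positivity
  obtain ⟨t, ht, ht1, ht2⟩ : ∃ t : ℝ, 0 < t ∧ t < ρ - dist y c ∧ t * M ≤ r := by
    refine ⟨min ((ρ - dist y c) / 2) (r / M), by positivity, ?_, ?_⟩
    · exact (min_le_left _ _).trans_lt (by linarith)
    · calc _ ≤ r / M * M := by gcongr; exact min_le_right _ _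
        _ = r := by field_simp
  -- The slack `t ε / 8` enters twice in each of the two monotonicity estimates, so a separation of
  -- `ε` drops to `ε / 2`.
  obtain ⟨Φ₀, hΦ₀, Ψ₀, hΨ₀, hlt⟩ := hbad y hy (t * (ε / 8)) (by positivity)
  obtain ⟨h, hh, hlt⟩ := exists_re_apply_gt hlt
  simp only [ContinuousLinearMap.comp_apply, sub_apply, map_sub] at hlt
  have hjh : ‖j h‖ ≤ ‖j‖ := (j.le_opNorm h).trans (mul_le_of_le_one_right (norm_nonneg _) hh)
  have key : ∀ g : Y, ‖g‖ ≤ 1 → y + (t : 𝕜) • g ∈ Metric.ball c ρ ∧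
      nearSupport 𝕜 (a + j (y + (t : 𝕜) • g)) (t * (ε / 8)) ⊆ nearSupport 𝕜 (a + j y) r := by
    intro g hg
    constructor
    · rw [Metric.mem_ball]
      calc dist (y + (t : 𝕜) • g) c ≤ dist (y + (t : 𝕜) • g) y + dist y c := dist_triangle _ _ _
        _ ≤ t + dist y c := by
          gcongr
          rw [dist_eq_norm, add_sub_cancel_left, norm_smul, RCLike.norm_ofReal, abs_of_pos ht]
          exact mul_le_of_le_one_right ht.le hg
        _ < ρ := by linarith
    · apply nearSupport_subset
      have : ‖a + j y - (a + j (y + (t : 𝕜) • g))‖ ≤ t * ‖j‖ := by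
        rw [map_add, map_smul, ← add_assoc, sub_add_cancel_left, norm_neg, norm_smul,
          RCLike.norm_ofReal, abs_of_pos ht]
        gcongr
        exact (j.le_opNorm g).trans (mul_le_of_le_one_right (norm_nonneg _) hg)
      rw [hM] at ht2
      linarith
  refine ⟨h, fun b => (y + (t : 𝕜) • (bif b then h else -h), t * (ε / 8)), hh, ?_, ?_⟩
  · intro b
    have hb : ‖(bif b then h else -h)‖ ≤ 1 := by cases b <;> simpa using hh
    exact ⟨(key _ hb).1, by positivity, (key _ hb).2⟩
  · intro Φ hΦ Ψ hΨ
    simp only [cond_true, cond_false, map_add, map_smul, ← add_assoc] at hΦ hΨ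
    have h1 := re_apply_of_mem_nearSupport_add hΦ₀ hΦ
    have h2 := re_apply_of_mem_nearSupport_add hΨ₀ hΨ
    simp only [map_neg] at h2
    rw [sub_apply, map_sub]
    refine le_of_mul_le_mul_left (a := t) ?_ ht
    have h3 := mul_lt_mul_of_pos_left hlt ht
    linarith

/-- A dyadic scheme of sets of functionals of the unit ball, closed under midpoints and separated
by the vectors `h s`, yields a dyadic tree of functionals separated by these vectors. -/
lemma exists_tree_of_scheme (K : List Bool → Set (StrongDual 𝕜 Z)) (h : List Bool → Z) {ε : ℝ}
    (hne : ∀ s, (K s).Nonempty) (hball : ∀ s, ∀ Φ ∈ K s, ‖Φ‖ ≤ 1)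
    (hmid : ∀ s, ∀ Φ ∈ K s, ∀ Ψ ∈ K s, (2⁻¹ : 𝕜) • (Φ + Ψ) ∈ K s)
    (hsub : ∀ b s, K (b :: s) ⊆ K s)
    (hsep : ∀ s, ∀ Φ ∈ K (true :: s), ∀ Ψ ∈ K (false :: s), ε ≤ RCLike.re ((Φ - Ψ) (h s))) :
    ∃ F : List Bool → StrongDual 𝕜 Z, (∀ s, ‖F s‖ ≤ 1) ∧
      (∀ s, F s = (2⁻¹ : 𝕜) • (F (true :: s) + F (false :: s))) ∧
      ∀ s, ε ≤ RCLike.re ((F (true :: s) - F (false :: s)) (h s)) := by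
  choose G hG using hne
  -- `A n s` averages the chosen points over the descendants of `s` that lie `n` generations below.
  -- Taking the limit along `n - s.length` makes all nodes average over the same generation `n`, so
  -- the midpoint relation holds once `n > s.length` and passes to the weak* limit.
  let A : ℕ → List Bool → StrongDual 𝕜 Z := fun n => Nat.rec G
    (fun _ B s => (2⁻¹ : 𝕜) • (B (true :: s) + B (false :: s))) n
  have hA : ∀ n s, A n s ∈ K s := by
    intro n
    induction n with
    | zero => exact hG
    | succ n ih => exact fun s => hmid s _ (hsub _ _ (ih _)) _ (hsub _ _ (ih _))
  let U : Ultrafilter ℕ := hyperfilter ℕ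
  have hlim : ∀ s, ∃ F : StrongDual 𝕜 Z, ‖F‖ ≤ 1 ∧
      ∀ z, Tendsto (fun n => A (n - s.length) s z) U (𝓝 (F z)) := by
    intro s
    have hc := WeakDual.isCompact_closedBall (0 : StrongDual 𝕜 Z) 1
    obtain ⟨F, hF, hF'⟩ := hc.ultrafilter_le_nhds
      (U.map fun n => StrongDual.toWeakDual (A (n - s.length) s)) (by
        rw [le_principal_iff]
        refine Filter.mem_map.2 (Filter.Eventually.of_forall fun n => ?_)
        simpa using hball s _ (hA _ s))
    refine ⟨WeakDual.toStrongDual F, by simpa using hF, fun z => ?_⟩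
    have h1 : Tendsto (fun n => StrongDual.toWeakDual (A (n - s.length) s)) U (𝓝 F) := hF'
    exact ((WeakDual.eval_continuous z).tendsto F).comp h1
  choose F hF hlim using hlim
  refine ⟨F, hF, fun s => ?_, fun s => ?_⟩
  · ext z
    refine tendsto_nhds_unique (hlim s z) ?_
    have h1 := ((hlim (true :: s) z).add (hlim (false :: s) z)).const_mul (2⁻¹ : 𝕜)
    refine h1.congr' ?_
    have h2 : ∀ᶠ n in (U : Filter ℕ), s.length + 1 ≤ n :=
      (Nat.hyperfilter_le_atTop) (eventually_ge_atTop _)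
    filter_upwards [h2] with n hn
    obtain ⟨k, rfl⟩ := Nat.exists_eq_add_of_le hn
    simp only [List.length_cons]
    rw [show s.length + 1 + k - (s.length + 1) = k by omega,
      show s.length + 1 + k - s.length = k + 1 by omega]
    rfl
  · have h1 := (RCLike.continuous_re.tendsto _).comp
      ((hlim (true :: s) (h s)).sub (hlim (false :: s) (h s)))
    refine ge_of_tendsto' h1 fun n => ?_
    exact hsep s _ (hA _ _) _ (hA _ _)

/-- A bounded separated dyadic tree is not dentable. -/
lemma not_hasRNP_of_tree {E : Type*} [NormedAddCommGroup E] [NormedSpace 𝕜 E]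
    (F : List Bool → E) {M ε : ℝ} (hε : 0 < ε) (hM : ∀ s, ‖F s‖ ≤ M)
    (hF : ∀ s, F s = (2⁻¹ : 𝕜) • (F (true :: s) + F (false :: s)))
    (hsep : ∀ s, ε ≤ ‖F (true :: s) - F (false :: s)‖) : ¬ HasRNP 𝕜 E := by
  intro hR
  have h2 : ((2 : 𝕜)⁻¹) = (((2 : ℝ)⁻¹ : ℝ) : 𝕜) := by push_cast; rfl
  have hb : Bornology.IsBounded (Set.range F) :=
    isBounded_iff_forall_norm_le.2 ⟨M, by rintro _ ⟨s, rfl⟩; exact hM s⟩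
  obtain ⟨f, α, hα, hd⟩ := hR (Set.range F) (Set.range_nonempty F) hb (ε / 2) (by positivity)
  obtain ⟨_, ⟨_, ⟨s, rfl⟩, rfl⟩, hs⟩ := exists_lt_of_lt_csSup
    ((Set.range_nonempty F).image fun z => RCLike.re (f z)) (sub_lt_self _ hα)
  -- A slice containing a node contains one of its children, and the child lies at half the distance
  -- between the siblings, at least `ε / 2`.
  have hchild : ∃ b, RCLike.re (f (F s)) ≤ RCLike.re (f (F (b :: s))) := by
    by_contra! hcon
    have h1 := hcon true
    have h3 := hcon false
    have h4 : RCLike.re (f (F s)) = 2⁻¹ * (RCLike.re (f (F (true :: s)))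
        + RCLike.re (f (F (false :: s)))) := by
      conv_lhs => rw [hF s]
      rw [map_smul, smul_eq_mul, h2, RCLike.re_ofReal_mul, map_add, map_add]
    linarith
  obtain ⟨b, hb'⟩ := hchild
  have hdist : dist (F s) (F (b :: s)) < ε / 2 := by
    refine (Metric.dist_le_diam_of_mem (hb.subset fun z hz => hz.1) ?_ ?_).trans_lt hd
    · exact ⟨⟨s, rfl⟩, hs⟩
    · exact ⟨⟨_, rfl⟩, hs.trans_le hb'⟩
  have heq : ‖F s - F (b :: s)‖ = 2⁻¹ * ‖F (true :: s) - F (false :: s)‖ := by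
    have hn : ‖(2⁻¹ : 𝕜)‖ = 2⁻¹ := by
      rw [h2, RCLike.norm_ofReal, abs_of_pos (by norm_num)]
    rw [← hn, ← norm_smul]
    have h3 : (1 : 𝕜) = 2⁻¹ + 2⁻¹ := by norm_num
    cases b
    · congr 1
      rw [hF s, ← one_smul 𝕜 (F (false :: s)), h3]
      module
    · rw [← norm_neg]
      congr 1
      rw [hF s, ← one_smul 𝕜 (F (true :: s)), h3]
      module
  rw [dist_eq_norm, heq] at hdist
  linarith [hsep s]

/-- If no such point existed, `exists_separated_nearSupport` could be iterated forever; composing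
the resulting tree with `j` would contradict the RNP of `Y*`. -/
lemma exists_small_nearSupport (hR : HasRNP 𝕜 (StrongDual 𝕜 Y)) (j : Y →L[𝕜] Z) (a : Z)
    (c : Y) {ρ ε : ℝ} (hρ : 0 < ρ) (hε : 0 < ε) :
    ∃ y ∈ Metric.ball c ρ, ∃ δ > 0, ∀ Φ ∈ nearSupport 𝕜 (a + j y) δ,
      ∀ Ψ ∈ nearSupport 𝕜 (a + j y) δ, ‖(Φ - Ψ).comp j‖ ≤ ε := by
  by_contra! hbad
  let N := {p : Y × ℝ // p.1 ∈ Metric.ball c ρ ∧ 0 < p.2}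
  let D : N → Set (StrongDual 𝕜 Z) := fun p => nearSupport 𝕜 (a + j p.1.1) p.1.2
  have hstep : ∀ p : N, ∃ (h : Y) (q : Bool → N), ‖h‖ ≤ 1 ∧ (∀ b, D (q b) ⊆ D p) ∧
      ∀ Φ ∈ D (q true), ∀ Ψ ∈ D (q false), ε / 2 ≤ RCLike.re ((Φ - Ψ) (j h)) := by
    intro p
    obtain ⟨h, q, h1, h2, h3⟩ := exists_separated_nearSupport j a hε hbad p.2.1 p.2.2
    exact ⟨h, fun b => ⟨q b, (h2 b).1, (h2 b).2.1⟩, h1, fun b => (h2 b).2.2, h3⟩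
  choose h q hh hD hsep using hstep
  let node : List Bool → N := fun s => List.rec ⟨(c, 1), Metric.mem_ball_self hρ, one_pos⟩
    (fun b _ p => q p b) s
  obtain ⟨F, hF, hmid, hFsep⟩ := exists_tree_of_scheme (fun s => D (node s))
    (fun s => j (h (node s))) (fun s => nearSupport_nonempty _ (node s).2.2)
    (fun s Φ hΦ => hΦ.1) (fun s Φ hΦ Ψ hΨ => half_add_mem_nearSupport hΦ hΨ)
    (fun b s => hD (node s) b) (fun s => hsep (node s))
  refine not_hasRNP_of_tree (fun s => (F s).comp j) (M := ‖j‖) (half_pos hε) (fun s => ?_)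
    (fun s => ?_) (fun s => ?_) hR
  · exact ((F s).opNorm_comp_le j).trans (mul_le_of_le_one_left (norm_nonneg _) (hF s))
  · ext y
    have := congrArg (fun G : StrongDual 𝕜 Z => G (j y)) (hmid s)
    simpa using this
  · refine (hFsep s).trans ?_
    have := re_apply_le ((F (true :: s)).comp j - (F (false :: s)).comp j) (h (node s))
    exact this.trans (mul_le_of_le_one_right (norm_nonneg _) (hh _))

/-- If `Y*` has the Radon-Nikodym property, then `y ↦ ‖a + j y‖` satisfies the Šmulyan test for
Fréchet differentiability at the points of a dense set. -/
theorem dense_smulyan [CompleteSpace Y] (hR : HasRNP 𝕜 (StrongDual 𝕜 Y)) (j : Y →L[𝕜] Z) (a : Z) :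
    Dense {y : Y | ∀ ε > 0, ∃ δ > 0, ∀ Φ ∈ nearSupport 𝕜 (a + j y) δ,
      ∀ Ψ ∈ nearSupport 𝕜 (a + j y) δ, ‖(Φ - Ψ).comp j‖ ≤ ε} := by
  let G : ℕ → Set Y := fun n => {y | ∃ δ > 0, ∀ Φ ∈ nearSupport 𝕜 (a + j y) δ,
      ∀ Ψ ∈ nearSupport 𝕜 (a + j y) δ, ‖(Φ - Ψ).comp j‖ ≤ 1 / ((n : ℝ) + 1)}
  have hopen : ∀ n, IsOpen (G n) := by
    intro n
    rw [isOpen_iff_mem_nhds]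
    rintro y ⟨δ, hδ, hy⟩
    have hc : Tendsto (fun y' => 2 * ‖(a + j y) - (a + j y')‖ + δ / 2) (𝓝 y)
        (𝓝 (2 * ‖(a + j y) - (a + j y)‖ + δ / 2)) :=
      Continuous.tendsto (by fun_prop) y
    have hlt : 2 * ‖(a + j y) - (a + j y)‖ + δ / 2 < δ := by
      rw [sub_self, norm_zero]; linarith
    filter_upwards [hc.eventually (gt_mem_nhds hlt)] with y' hy'
    have hs := nearSupport_subset (𝕜 := 𝕜) hy'.le
    exact ⟨δ / 2, half_pos hδ, fun Φ hΦ Ψ hΨ => hy Φ (hs hΦ) Ψ (hs hΨ)⟩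
  have hdense : ∀ n, Dense (G n) := by
    intro n
    rw [Metric.dense_iff]
    intro c ρ hρ
    obtain ⟨y, hy, h⟩ := exists_small_nearSupport hR j a c hρ
      (show (0 : ℝ) < 1 / ((n : ℝ) + 1) by positivity)
    exact ⟨y, hy, h⟩
  refine (dense_iInter_of_isOpen_nat hopen hdense).mono fun y hy ε hε => ?_
  obtain ⟨n, hn⟩ := exists_nat_one_div_lt hε
  obtain ⟨δ, hδ, h⟩ := Set.mem_iInter.1 hy n
  exact ⟨δ, hδ, fun Φ hΦ Ψ hΨ => (h Φ hΦ Ψ hΨ).trans hn.le⟩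

end NearSupport

end NormAttaining

namespace NormAttaining

/-! ### Density of operators whose norm is isolated at one functional. -/

section Norming

variable {𝕜 : Type*} [RCLike 𝕜] {X : Type*} [NormedAddCommGroup X] [NormedSpace 𝕜 X]
  {Y : Type*} [NormedAddCommGroup Y] [NormedSpace 𝕜 Y]

lemma ne_zero_of_norm_eq_one {θ : 𝕜} (hθ : ‖θ‖ = 1) : θ ≠ 0 :=
  norm_ne_zero_iff.1 (by rw [hθ]; exact one_ne_zero)

lemma norm_comp_le_of_norm_le_one {f : StrongDual 𝕜 Y} (hf : ‖f‖ ≤ 1) (T : X →L[𝕜] Y) :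
    ‖f.comp T‖ ≤ ‖T‖ :=
  (f.opNorm_comp_le T).trans (mul_le_of_le_one_left (norm_nonneg _) hf)

lemma norm_smul_comp {θ : 𝕜} (hθ : ‖θ‖ = 1) (f : StrongDual 𝕜 Y) (T : X →L[𝕜] Y) :
    ‖(θ • f).comp T‖ = ‖f.comp T‖ := by
  rw [ContinuousLinearMap.smul_comp, norm_smul, hθ, one_mul]

lemma norm_comp_le_norm_comp_add {f : StrongDual 𝕜 Y} (hf : ‖f‖ ≤ 1) (T S : X →L[𝕜] Y) :
    ‖f.comp T‖ ≤ ‖f.comp S‖ + ‖T - S‖ := by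
  have h1 := norm_sub_norm_le (f.comp T) (f.comp S)
  have h2 := norm_comp_le_of_norm_le_one hf (T - S)
  rw [ContinuousLinearMap.comp_sub] at h2
  linarith

lemma norm_le_one_of_mem_wStarStrExp {f : StrongDual 𝕜 Y}
    (hf : f ∈ wStarStrExp 𝕜 (Metric.closedBall (0 : StrongDual 𝕜 Y) 1)) : ‖f‖ ≤ 1 := by
  obtain ⟨y, h, -⟩ := hf
  exact mem_closedBall_zero_iff.1 h

lemma smul_mem_wStarStrExp {f : StrongDual 𝕜 Y}
    (hf : f ∈ wStarStrExp 𝕜 (Metric.closedBall (0 : StrongDual 𝕜 Y) 1)) {θ : 𝕜} (hθ : ‖θ‖ = 1) :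
    θ • f ∈ wStarStrExp 𝕜 (Metric.closedBall (0 : StrongDual 𝕜 Y) 1) := by
  obtain ⟨y, h1, h2, h3⟩ := hf
  have hθ0 := ne_zero_of_norm_eq_one hθ
  have hmem : ∀ (c : 𝕜), ‖c‖ = 1 → ∀ g ∈ Metric.closedBall (0 : StrongDual 𝕜 Y) 1,
      c • g ∈ Metric.closedBall (0 : StrongDual 𝕜 Y) 1 := by
    intro c hc g hg
    rw [mem_closedBall_zero_iff] at hg ⊢
    rwa [norm_smul, hc, one_mul]
  have hθ' : ‖θ⁻¹‖ = 1 := by rw [norm_inv, hθ, inv_one]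
  have heq : ∀ g : StrongDual 𝕜 Y, NormedSpace.inclusionInDoubleDual 𝕜 Y (θ⁻¹ • y) g =
      NormedSpace.inclusionInDoubleDual 𝕜 Y y (θ⁻¹ • g) := by
    intro g
    rw [map_smul, map_smul]
    rfl
  refine ⟨θ⁻¹ • y, hmem θ hθ f h1, fun g hg => ?_, fun u hu hlim => ?_⟩
  · rw [heq, heq, inv_smul_smul₀ hθ0]
    exact h2 _ (hmem _ hθ' g hg)
  · simp only [heq, inv_smul_smul₀ hθ0] at hlim
    have h4 := (h3 _ (fun n => hmem _ hθ' _ (hu n)) hlim).const_smul θ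
    simpa only [smul_inv_smul₀ hθ0] using h4

/-- If `Y*` has the Radon-Nikodym property, then the `w*`-strongly exposed points of the dual unit
ball are norming. -/
lemma exists_mem_wStarStrExp_lt_re [CompleteSpace Y] (hR : HasRNP 𝕜 (StrongDual 𝕜 Y)) (y : Y)
    {ε : ℝ} (hε : 0 < ε) :
    ∃ f ∈ wStarStrExp 𝕜 (Metric.closedBall (0 : StrongDual 𝕜 Y) 1),
      ‖y‖ - ε < RCLike.re (f y) := by
  -- With `j = id` and `a = 0` the test concerns the norm of `Y` itself: such a `y'` strongly
  -- exposes any functional norming it.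
  obtain ⟨y', hy', hd⟩ := (dense_smulyan hR (ContinuousLinearMap.id 𝕜 Y) 0).exists_dist_lt y
    (half_pos hε)
  simp only [Set.mem_ofPred_eq, zero_add, ContinuousLinearMap.id_apply,
    ContinuousLinearMap.comp_id] at hy'
  obtain ⟨f, hf, hfy⟩ := exists_dual_vector'' 𝕜 y'
  have hre : RCLike.re (f y') = ‖y'‖ := by rw [hfy, RCLike.ofReal_re]
  refine ⟨f, ⟨y', mem_closedBall_zero_iff.2 hf, fun g hg => ?_, fun u hu hlim => ?_⟩, ?_⟩
  · rw [NormedSpace.dual_def, NormedSpace.dual_def, hre]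
    exact re_apply_le_norm (mem_closedBall_zero_iff.1 hg) y'
  · simp only [NormedSpace.dual_def, hre] at hlim
    rw [Metric.tendsto_atTop']
    intro η hη
    obtain ⟨δ, hδ, h⟩ := hy' (η / 2) (half_pos hη)
    obtain ⟨n₀, hn₀⟩ := eventually_atTop.1 (hlim.eventually (lt_mem_nhds (sub_lt_self ‖y'‖ hδ)))
    refine ⟨n₀, fun n hn => ?_⟩
    rw [dist_eq_norm]
    refine (h (u n) ⟨mem_closedBall_zero_iff.1 (hu n), hn₀ n hn.le⟩ f ⟨hf, ?_⟩).trans_lt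
      (half_lt_self hη)
    linarith
  · have h1 := re_apply_le_norm hf (y' - y)
    rw [map_sub, map_sub, hre, norm_sub_rev] at h1
    rw [dist_eq_norm] at hd
    have h2 := norm_sub_norm_le y y'
    linarith

lemma exists_mem_wStarStrExp_lt_norm_comp [CompleteSpace Y] (hR : HasRNP 𝕜 (StrongDual 𝕜 Y))
    (T : X →L[𝕜] Y) {ε : ℝ} (hε : 0 < ε) :
    ∃ f ∈ wStarStrExp 𝕜 (Metric.closedBall (0 : StrongDual 𝕜 Y) 1), ‖T‖ - ε < ‖f.comp T‖ := by
  obtain ⟨x, hx, hTx⟩ := T.exists_lt_apply_of_lt_opNorm (sub_lt_self ‖T‖ (half_pos hε))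
  obtain ⟨f, hf, hfx⟩ := exists_mem_wStarStrExp_lt_re hR (T x) (half_pos hε)
  refine ⟨f, hf, ?_⟩
  have h1 := re_apply_le (f.comp T) x
  have h2 : ‖f.comp T‖ * ‖x‖ ≤ ‖f.comp T‖ := mul_le_of_le_one_right (norm_nonneg _) hx.le
  rw [ContinuousLinearMap.comp_apply] at h1
  linarith

/-- If the values of a functional at a rotated and at the original sequence have the same limit
`s > 0`, then the rotations may be dropped. -/
lemma tendsto_of_tendsto_smul {E : Type*} [NormedAddCommGroup E] [NormedSpace 𝕜 E]
    (G : StrongDual 𝕜 E) {u : ℕ → E} {θ : ℕ → 𝕜} {x : E} {s : ℝ} (hs : 0 < s)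
    (hθ : ∀ n, ‖θ n‖ = 1) (hlim : Tendsto (fun n => θ n • u n) atTop (𝓝 x))
    (hGx : G x = (s : 𝕜)) (hle : ∀ n, ‖G (u n)‖ ≤ s)
    (hG : Tendsto (fun n => RCLike.re (G (u n))) atTop (𝓝 s)) : Tendsto u atTop (𝓝 x) := by
  have hs0 : (s : 𝕜) ≠ 0 := by exact_mod_cast hs.ne'
  have h1 : Tendsto (fun n => G (u n)) atTop (𝓝 (s : 𝕜)) := by
    rw [tendsto_iff_norm_sub_tendsto_zero]
    have h2 : ∀ n, ‖G (u n) - (s : 𝕜)‖ ≤ √(2 * s * (s - RCLike.re (G (u n)))) := by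
      intro n
      apply Real.le_sqrt_of_sq_le
      have h3 : ‖G (u n) - (s : 𝕜)‖ ^ 2 = ‖G (u n)‖ ^ 2 - 2 * s * RCLike.re (G (u n)) + s ^ 2 := by
        rw [← RCLike.normSq_eq_def', ← RCLike.normSq_eq_def', RCLike.normSq_apply,
          RCLike.normSq_apply, map_sub, map_sub, RCLike.ofReal_re, RCLike.ofReal_im]
        ring
      have h4 : ‖G (u n)‖ ^ 2 ≤ s ^ 2 := by gcongr; exact hle n
      rw [h3]
      linarith
    have h5 : Tendsto (fun n => √(2 * s * (s - RCLike.re (G (u n))))) atTop (𝓝 0) := by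
      have := ((tendsto_const_nhds (x := s)).sub hG).const_mul (2 * s)
      rw [sub_self, mul_zero] at this
      simpa using this.sqrt
    exact squeeze_zero (fun n => norm_nonneg _) h2 h5
  have h2 : Tendsto (fun n => θ n * G (u n)) atTop (𝓝 (s : 𝕜)) := by
    have := (G.continuous.tendsto x).comp hlim
    rw [hGx] at this
    exact this.congr fun n => by simp
  have h3 : Tendsto (fun n => (θ n)⁻¹) atTop (𝓝 1) := by
    have h4 := h1.div h2 hs0
    rw [div_self hs0] at h4
    refine h4.congr' ?_
    filter_upwards [h1.eventually_ne hs0] with n hn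
    have := ne_zero_of_norm_eq_one (hθ n)
    simp only [Pi.div_apply]
    field_simp
  have h4 := h3.smul hlim
  rw [one_smul] at h4
  exact h4.congr fun n => inv_smul_smul₀ (ne_zero_of_norm_eq_one (hθ n)) _

/-- If the adjoint of `S` attains its norm at `f₀` strongly up to rotations, then `f₀` is a strongly
exposed point of the dual ball. -/
lemma mem_strExp_of_tendsto_smul {S : X →L[𝕜] Y} (hS : S ≠ 0) {f₀ : StrongDual 𝕜 Y}
    (hf₀ : ‖f₀‖ ≤ 1) (hatt : ‖f₀.comp S‖ = ‖S‖)
    (hstr : ∀ u : ℕ → StrongDual 𝕜 Y, (∀ n, ‖u n‖ ≤ 1) →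
      Tendsto (fun n => ‖(u n).comp S‖) atTop (𝓝 ‖S‖) →
      ∃ θ : ℕ → 𝕜, (∀ n, ‖θ n‖ = 1) ∧ Tendsto (fun n => θ n • u n) atTop (𝓝 f₀)) :
    f₀ ∈ strExp 𝕜 (Metric.closedBall (0 : StrongDual 𝕜 Y) 1) := by
  -- The exposing functional is `f ↦ Ξ (f ∘ S)`, where `Ξ ∈ X**` norms `f₀ ∘ S`.
  obtain ⟨Ξ, hΞ, hΞf⟩ := exists_dual_vector'' 𝕜 (f₀.comp S)
  let G : StrongDual 𝕜 (StrongDual 𝕜 Y) := Ξ.comp ((ContinuousLinearMap.compL 𝕜 X Y 𝕜).flip S)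
  have hG : ∀ f, G f = Ξ (f.comp S) := fun f => rfl
  have hGle : ∀ f, ‖G f‖ ≤ ‖f.comp S‖ := fun f =>
    (Ξ.le_opNorm _).trans (mul_le_of_le_one_left (norm_nonneg _) hΞ)
  have hGf : G f₀ = ((‖S‖ : ℝ) : 𝕜) := by rw [hG, hΞf, hatt]
  refine ⟨G, mem_closedBall_zero_iff.2 hf₀, fun f hf => ?_, fun u hu hlim => ?_⟩
  · rw [hGf, RCLike.ofReal_re]
    exact (RCLike.re_le_norm _).trans ((hGle f).trans
      (norm_comp_le_of_norm_le_one (mem_closedBall_zero_iff.1 hf) S))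
  · rw [hGf, RCLike.ofReal_re] at hlim
    have hu' : ∀ n, ‖u n‖ ≤ 1 := fun n => mem_closedBall_zero_iff.1 (hu n)
    have h1 : Tendsto (fun n => ‖(u n).comp S‖) atTop (𝓝 ‖S‖) :=
      tendsto_of_tendsto_of_tendsto_of_le_of_le hlim tendsto_const_nhds
        (fun n => (RCLike.re_le_norm _).trans (hGle _))
        (fun n => norm_comp_le_of_norm_le_one (hu' n) S)
    obtain ⟨θ, hθ, h2⟩ := hstr u hu' h1
    exact tendsto_of_tendsto_smul G (norm_pos_iff.2 hS) hθ h2 hGf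
      (fun n => (hGle _).trans (norm_comp_le_of_norm_le_one (hu' n) S)) hlim

/-- `f₀` is, up to rotations, the only `w*`-strongly exposed functional at which the adjoint of `T`
comes close to its norm. -/
def IsolatesNorm (T : X →L[𝕜] Y) (f₀ : StrongDual 𝕜 Y) : Prop :=
  f₀ ∈ wStarStrExp 𝕜 (Metric.closedBall (0 : StrongDual 𝕜 Y) 1) ∧ f₀ ≠ 0 ∧
    ∃ δ > 0, ∀ f ∈ wStarStrExp 𝕜 (Metric.closedBall (0 : StrongDual 𝕜 Y) 1),
      (∃ θ : 𝕜, ‖θ‖ = 1 ∧ f = θ • f₀) ∨ ‖f.comp T‖ ≤ ‖T‖ - δ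

/-- A maximizing sequence of `w*`-strongly exposed functionals exists, so `f₀` attains `‖S‖` and is
strongly exposed. Were there no gap, suitably rotated `w*`-strongly exposed functionals, none a
rotation of `f₀`, would converge to `f₀`, against discreteness. The gap in turn shows that `f₀` is
`w*`-strongly exposed. -/
lemma isolatesNorm_of_tendsto_smul [CompleteSpace Y] (hR : HasRNP 𝕜 (StrongDual 𝕜 Y))
    (hD : DualDiscreteUpToRotations 𝕜 Y) {S : X →L[𝕜] Y} (hS : S ≠ 0) {f₀ : StrongDual 𝕜 Y}
    (hf₀ : ‖f₀‖ ≤ 1)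
    (hstr : ∀ u : ℕ → StrongDual 𝕜 Y, (∀ n, ‖u n‖ ≤ 1) →
      Tendsto (fun n => ‖(u n).comp S‖) atTop (𝓝 ‖S‖) →
      ∃ θ : ℕ → 𝕜, (∀ n, ‖θ n‖ = 1) ∧ Tendsto (fun n => θ n • u n) atTop (𝓝 f₀)) :
    IsolatesNorm S f₀ := by
  have hlim : ∀ u : ℕ → StrongDual 𝕜 Y, (∀ n, ‖u n‖ ≤ 1) →
      (∀ n : ℕ, ‖S‖ - 1 / ((n : ℝ) + 1) < ‖(u n).comp S‖) →
      Tendsto (fun n => ‖(u n).comp S‖) atTop (𝓝 ‖S‖) := by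
    intro u hu h
    have h1 := (tendsto_const_nhds (x := ‖S‖)).sub
      (tendsto_one_div_add_atTop_nhds_zero_nat (𝕜 := ℝ))
    rw [sub_zero] at h1
    exact tendsto_of_tendsto_of_tendsto_of_le_of_le h1 tendsto_const_nhds
      (fun n => (h n).le) (fun n => norm_comp_le_of_norm_le_one (hu n) S)
  have hatt : ‖f₀.comp S‖ = ‖S‖ := by
    choose u hu hu' using fun n : ℕ => exists_mem_wStarStrExp_lt_norm_comp hR S
      (show (0 : ℝ) < 1 / ((n : ℝ) + 1) by positivity)
    have h1 := hlim u (fun n => norm_le_one_of_mem_wStarStrExp (hu n)) hu'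
    obtain ⟨θ, hθ, h2⟩ := hstr u (fun n => norm_le_one_of_mem_wStarStrExp (hu n)) h1
    have hc : Continuous fun f : StrongDual 𝕜 Y => ‖f.comp S‖ := by fun_prop
    have h3 := (hc.tendsto f₀).comp h2
    refine tendsto_nhds_unique h3 (h1.congr fun n => ?_)
    exact (norm_smul_comp (hθ n) (u n) S).symm
  have hexp := mem_strExp_of_tendsto_smul hS hf₀ hatt hstr
  have hgap : ∃ δ > 0, ∀ f ∈ wStarStrExp 𝕜 (Metric.closedBall (0 : StrongDual 𝕜 Y) 1),
      (∃ θ : 𝕜, ‖θ‖ = 1 ∧ f = θ • f₀) ∨ ‖f.comp S‖ ≤ ‖S‖ - δ := by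
    by_contra! hcon
    choose u hu hrot hu' using fun n : ℕ => hcon (1 / ((n : ℝ) + 1)) (by positivity)
    have hu1 := fun n => norm_le_one_of_mem_wStarStrExp (hu n)
    obtain ⟨θ, hθ, h2⟩ := hstr u hu1 (hlim u hu1 hu')
    obtain ⟨n₀, θ', hθ', h3⟩ := hD _ f₀ (fun n => smul_mem_wStarStrExp (hu n) (hθ n)) hexp h2
    refine hrot n₀ ((θ n₀)⁻¹ * θ' n₀) ?_ ?_
    · rw [norm_mul, norm_inv, hθ, hθ', inv_one, one_mul]
    · rw [mul_smul, ← h3 n₀ le_rfl, inv_smul_smul₀ (ne_zero_of_norm_eq_one (hθ _))]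
  refine ⟨?_, ?_, hgap⟩
  · obtain ⟨δ, hδ, h⟩ := hgap
    obtain ⟨f, hf, hfS⟩ := exists_mem_wStarStrExp_lt_norm_comp hR S hδ
    rcases h f hf with ⟨θ, hθ, rfl⟩ | h1
    · have := smul_mem_wStarStrExp hf (θ := θ⁻¹) (by rw [norm_inv, hθ, inv_one])
      rwa [inv_smul_smul₀ (ne_zero_of_norm_eq_one hθ)] at this
    · exact absurd hfS h1.not_gt
  · rintro rfl
    rw [ContinuousLinearMap.zero_comp, norm_zero] at hatt
    exact hS (norm_eq_zero.1 hatt.symm)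

/-- The Šmulyan test for `y ↦ ‖T + φ ⊗ y‖` forces the adjoint of `S = T + φ ⊗ y` to attain its norm
strongly up to rotations, when `φ` is bounded away from zero where `S` nearly attains its norm. -/
lemma exists_tendsto_smul_of_smulyan {S : X →L[𝕜] Y} (hS : S ≠ 0) (φ : StrongDual 𝕜 X)
    (hφ : ∃ η > 0, ∃ κ > 0, ∀ x, ‖x‖ ≤ 1 → ‖S‖ - η < ‖S x‖ → κ ≤ ‖φ x‖)
    (hsm : ∀ ε > 0, ∃ δ > 0, ∀ Φ ∈ nearSupport 𝕜 S δ, ∀ Ψ ∈ nearSupport 𝕜 S δ,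
      ‖(Φ - Ψ).comp (ContinuousLinearMap.smulRightL 𝕜 X Y φ)‖ ≤ ε) :
    ∃ f₀ : StrongDual 𝕜 Y, ‖f₀‖ ≤ 1 ∧ ∀ u : ℕ → StrongDual 𝕜 Y, (∀ n, ‖u n‖ ≤ 1) →
      Tendsto (fun n => ‖(u n).comp S‖) atTop (𝓝 ‖S‖) →
      ∃ θ : ℕ → 𝕜, (∀ n, ‖θ n‖ = 1) ∧ Tendsto (fun n => θ n • u n) atTop (𝓝 f₀) := by
  obtain ⟨Φ₀, hΦ₀, hΦ₀S⟩ := exists_dual_vector'' 𝕜 S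
  set J := ContinuousLinearMap.smulRightL 𝕜 X Y φ with hJ
  set F : StrongDual 𝕜 Y := Φ₀.comp J with hF
  obtain ⟨η, hη, κ, hκ, hφ⟩ := hφ
  have hSpos : 0 < ‖S‖ := norm_pos_iff.2 hS
  have key : ∀ u : ℕ → StrongDual 𝕜 Y, (∀ n, ‖u n‖ ≤ 1) →
      Tendsto (fun n => ‖(u n).comp S‖) atTop (𝓝 ‖S‖) →
      ∃ c : ℕ → 𝕜, (∀ᶠ n in atTop, κ ≤ ‖c n‖) ∧ Tendsto (fun n => c n • u n) atTop (𝓝 F) ∧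
        Tendsto (fun n => ‖c n‖) atTop (𝓝 ‖F‖) := by
    intro u hu hlim
    have hx : ∀ n : ℕ, ∃ x : X, ‖x‖ ≤ 1 ∧
        ‖(u n).comp S‖ - 1 / ((n : ℝ) + 1) < RCLike.re (u n (S x)) := by
      intro n
      obtain ⟨x, hx, h⟩ := ((u n).comp S).exists_lt_apply_of_lt_opNorm
        (sub_lt_self ‖(u n).comp S‖ (show (0 : ℝ) < 1 / ((n : ℝ) + 1) by positivity))
      obtain ⟨θ, hθ, h2⟩ := exists_unit_mul_eq_norm ((u n).comp S x)
      refine ⟨θ • x, by rw [norm_smul, hθ, one_mul]; exact hx.le, ?_⟩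
      rw [map_smul, map_smul, smul_eq_mul]
      rw [ContinuousLinearMap.comp_apply] at h2 h
      rwa [h2, RCLike.ofReal_re]
    choose x hx hx' using hx
    have hre : Tendsto (fun n => RCLike.re (u n (S (x n)))) atTop (𝓝 ‖S‖) := by
      have h1 := hlim.sub (tendsto_one_div_add_atTop_nhds_zero_nat (𝕜 := ℝ))
      rw [sub_zero] at h1
      refine tendsto_of_tendsto_of_tendsto_of_le_of_le h1 tendsto_const_nhds
        (fun n => (hx' n).le) (fun n => ?_)
      refine (re_apply_le_norm (hu n) _).trans ?_
      exact (S.le_opNorm _).trans (mul_le_of_le_one_right (norm_nonneg _) (hx n))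
    -- The functionals `R ↦ u n (R (x n))` nearly support `S`, and along `y ↦ φ ⊗ y` they become `φ
    -- (x n) • u n`. Šmulyan's test therefore makes these multiples converge in norm.
    let Φ : ℕ → StrongDual 𝕜 (X →L[𝕜] Y) := fun n =>
      (u n).comp (ContinuousLinearMap.apply 𝕜 Y (x n))
    have hΦ : ∀ n, ‖Φ n‖ ≤ 1 := by
      intro n
      refine ContinuousLinearMap.opNorm_le_bound _ zero_le_one fun R => ?_
      rw [one_mul]
      calc ‖u n (R (x n))‖ ≤ ‖u n‖ * ‖R (x n)‖ := (u n).le_opNorm _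
        _ ≤ 1 * (‖R‖ * ‖x n‖) := by gcongr; exacts [hu n, R.le_opNorm _]
        _ ≤ 1 * (‖R‖ * 1) := by gcongr; exact hx n
        _ = ‖R‖ := by ring
    have hΦJ : ∀ n, (Φ n).comp J = φ (x n) • u n := by
      intro n
      ext y
      simp [Φ, hJ]
    have hconv : Tendsto (fun n => φ (x n) • u n) atTop (𝓝 F) := by
      rw [Metric.tendsto_atTop']
      intro ε hε
      obtain ⟨δ, hδ, h⟩ := hsm (ε / 2) (half_pos hε)
      obtain ⟨n₀, hn₀⟩ := eventually_atTop.1 (hre.eventually (lt_mem_nhds (sub_lt_self ‖S‖ hδ)))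
      refine ⟨n₀, fun n hn => ?_⟩
      rw [dist_eq_norm, ← hΦJ, hF, ← ContinuousLinearMap.sub_comp]
      refine (h (Φ n) ⟨hΦ n, hn₀ n hn.le⟩ Φ₀ ⟨hΦ₀, ?_⟩).trans_lt (half_lt_self hε)
      rw [hΦ₀S, RCLike.ofReal_re]
      linarith
    have hunorm : Tendsto (fun n => ‖u n‖) atTop (𝓝 1) := by
      have h1 := hlim.div_const ‖S‖
      rw [div_self hSpos.ne'] at h1
      refine tendsto_of_tendsto_of_tendsto_of_le_of_le h1 tendsto_const_nhds (fun n => ?_) hu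
      rw [div_le_iff₀ hSpos]
      exact (u n).opNorm_comp_le S
    refine ⟨fun n => φ (x n), ?_, hconv, ?_⟩
    · filter_upwards [hre.eventually (lt_mem_nhds (sub_lt_self ‖S‖ hη))] with n hn
      exact hφ _ (hx n) (hn.trans_le (re_apply_le_norm (hu n) _))
    · have h1 := hconv.norm.div hunorm one_ne_zero
      rw [div_one] at h1
      refine h1.congr' ?_
      filter_upwards [hunorm.eventually_ne one_ne_zero] with n hn
      simp only [Pi.div_apply]
      rw [norm_smul, mul_div_cancel_right₀ _ hn]
  -- The lower bound `κ` on the multipliers rules out maximizing sequences here, so any `f₀` serves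
  -- vacuously.
  by_cases hF0 : F = 0
  · refine ⟨0, by simp, fun u hu hlim => ?_⟩
    obtain ⟨c, hc, -, hc'⟩ := key u hu hlim
    rw [hF0, norm_zero] at hc'
    have := ge_of_tendsto hc' hc
    linarith
  have hF1 : ‖F‖ ≠ 0 := norm_ne_zero_iff.2 hF0
  have hF2 : (‖F‖ : 𝕜) ≠ 0 := by exact_mod_cast hF1
  refine ⟨(‖F‖ : 𝕜)⁻¹ • F, ?_, fun u hu hlim => ?_⟩
  · rw [norm_smul, norm_inv, RCLike.norm_ofReal, abs_norm, inv_mul_cancel₀ hF1]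
  · obtain ⟨c, -, hconv, hc⟩ := key u hu hlim
    choose τ hτ hτc using fun n => RCLike.exists_norm_eq_mul_self (c n)
    refine ⟨fun n => (τ n)⁻¹, fun n => by rw [norm_inv, hτ, inv_one], ?_⟩
    have hc2 : Tendsto (fun n => ((‖c n‖ : ℝ) : 𝕜)⁻¹) atTop (𝓝 (‖F‖ : 𝕜)⁻¹) :=
      ((RCLike.continuous_ofReal.tendsto _).comp hc).inv₀ hF2
    refine (hc2.smul hconv).congr' ?_
    filter_upwards [hc.eventually_ne hF1] with n hn
    have hcn : c n ≠ 0 := norm_ne_zero_iff.1 hn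
    rw [smul_smul, hτc n, mul_inv, mul_assoc, inv_mul_cancel₀ hcn, mul_one]

lemma exists_norm_add_smul_eq (𝕜 : Type*) [RCLike 𝕜] {Y : Type*} [NormedAddCommGroup Y]
    [NormedSpace 𝕜 Y] [Nontrivial Y] (y : Y) {ε : ℝ} (hε : 0 ≤ ε) :
    ∃ v : Y, ‖v‖ = ε ∧ ‖y + v‖ = ‖y‖ + ε := by
  by_cases hy : y = 0
  · obtain ⟨v, hv⟩ := NormedSpace.exists_lt_norm 𝕜 Y 0
    refine ⟨((ε / ‖v‖ : ℝ) : 𝕜) • v, ?_, ?_⟩ <;>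
      simp [hy, norm_smul, abs_of_nonneg hε, hv.ne']
  · have hy' : ‖y‖ ≠ 0 := norm_ne_zero_iff.2 hy
    refine ⟨((ε / ‖y‖ : ℝ) : 𝕜) • y, ?_, ?_⟩
    · rw [norm_smul, RCLike.norm_ofReal, abs_of_nonneg (by positivity), div_mul_cancel₀ _ hy']
    · have h1 : y + ((ε / ‖y‖ : ℝ) : 𝕜) • y = ((1 + ε / ‖y‖ : ℝ) : 𝕜) • y := by
        rw [RCLike.ofReal_add, add_smul, RCLike.ofReal_one, one_smul]
      rw [h1, norm_smul, RCLike.norm_ofReal, abs_of_nonneg (by positivity)]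
      field_simp

/-- The perturbation pushes `T` in the direction of `T x₀` at a nearly maximizing `x₀` with `φ x₀ =
1`. This raises the norm by more than `3e/4`, whereas points with `|φ z| < 1/2` gain at most `9e/16
< 3e/4 - e/8`. Hence `φ` is bounded below where the norm is nearly attained. -/
theorem exists_isolatesNorm [Nontrivial X] [Nontrivial Y] [CompleteSpace Y]
    (hR : HasRNP 𝕜 (StrongDual 𝕜 Y)) (hD : DualDiscreteUpToRotations 𝕜 Y) (T : X →L[𝕜] Y)
    {ε : ℝ} (hε : 0 < ε) :
    ∃ (φ : StrongDual 𝕜 X) (y : Y) (f₀ : StrongDual 𝕜 Y), ‖φ.smulRight y‖ < ε ∧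
      IsolatesNorm (T + φ.smulRight y) f₀ := by
  obtain ⟨e, he, heε⟩ : ∃ e : ℝ, 0 < e ∧ 2 * e ≤ ε := ⟨ε / 2, half_pos hε, by linarith⟩
  obtain ⟨x, hx, hTx⟩ := T.exists_lt_apply_of_lt_opNorm
    (sub_lt_self ‖T‖ (show (0 : ℝ) < e / 8 by positivity))
  obtain ⟨φ, hφ, x₀, hx₀, hφx₀, hTx₀⟩ : ∃ φ : StrongDual 𝕜 X, ‖φ‖ = 1 ∧ ∃ x₀ : X, ‖x₀‖ = 1 ∧
      φ x₀ = 1 ∧ ‖T‖ - e / 8 < ‖T x₀‖ := by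
    obtain ⟨x₀, hx₀, hT⟩ : ∃ x₀ : X, ‖x₀‖ = 1 ∧ ‖T‖ - e / 8 < ‖T x₀‖ := by
      by_cases hx0 : x = 0
      · obtain ⟨z, hz, -⟩ := exists_norm_add_smul_eq 𝕜 (0 : X) zero_le_one
        refine ⟨z, hz, ?_⟩
        rw [hx0, map_zero, norm_zero] at hTx
        exact hTx.trans_le (norm_nonneg _)
      · have hxn : ‖x‖ ≠ 0 := norm_ne_zero_iff.2 hx0
        refine ⟨(‖x‖ : 𝕜)⁻¹ • x, ?_, ?_⟩
        · rw [norm_smul, norm_inv, RCLike.norm_ofReal, abs_norm, inv_mul_cancel₀ hxn]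
        · rw [map_smul, norm_smul, norm_inv, RCLike.norm_ofReal, abs_norm]
          refine hTx.trans_le (le_mul_of_one_le_left (norm_nonneg _) ?_)
          exact (one_le_inv₀ (norm_pos_iff.2 hx0)).2 hx.le
    obtain ⟨φ, hφ, hφx⟩ := exists_dual_vector 𝕜 x₀ (by rw [hx₀]; exact one_ne_zero)
    exact ⟨φ, hφ, x₀, hx₀, by rw [hφx, hx₀, RCLike.ofReal_one], hT⟩
  obtain ⟨v, hv, hTv⟩ := exists_norm_add_smul_eq 𝕜 (T x₀) he.le
  obtain ⟨y, hy, hyv⟩ := (dense_smulyan hR (ContinuousLinearMap.smulRightL 𝕜 X Y φ) T).exists_dist_lt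
    v (show (0 : ℝ) < e / 8 by positivity)
  rw [dist_eq_norm] at hyv
  have hyn : ‖y‖ < e + e / 8 := by
    have := norm_sub_norm_le y v
    rw [norm_sub_rev] at this
    linarith
  have hJ : ContinuousLinearMap.smulRightL 𝕜 X Y φ y = φ.smulRight y := rfl
  rw [Set.mem_ofPred_eq, hJ] at hy
  set S := T + φ.smulRight y with hSdef
  have hSn : ‖T‖ + e * (3 / 4) < ‖S‖ := by
    have h1 : ‖S x₀‖ ≤ ‖S‖ := by simpa [hx₀] using S.le_opNorm x₀
    have h2 : S x₀ = (T x₀ + v) - (v - y) := by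
      simp only [hSdef, add_apply, ContinuousLinearMap.smulRight_apply, hφx₀, one_smul]
      abel
    have h3 := norm_sub_norm_le (T x₀ + v) (v - y)
    rw [← h2] at h3
    linarith
  have hS0 : S ≠ 0 := by
    rintro h
    rw [h, norm_zero] at hSn
    have := norm_nonneg T
    linarith
  obtain ⟨f₀, hf₀, hstr⟩ := exists_tendsto_smul_of_smulyan hS0 φ
    ⟨e / 8, by positivity, 1 / 2, by norm_num, fun z hz hSz => by
      by_contra! hlt
      have h1 : ‖S z‖ ≤ ‖T z‖ + ‖φ z‖ * ‖y‖ := by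
        rw [← norm_smul]
        exact norm_add_le _ _
      have h2 : ‖T z‖ ≤ ‖T‖ := (T.le_opNorm z).trans (mul_le_of_le_one_right (norm_nonneg _) hz)
      have h3 : ‖φ z‖ * ‖y‖ ≤ 1 / 2 * (e + e / 8) := by gcongr
      linarith⟩ hy
  refine ⟨φ, y, f₀, ?_, isolatesNorm_of_tendsto_smul hR hD hS0 hf₀ hstr⟩
  rw [ContinuousLinearMap.norm_smulRight_apply, hφ]
  linarith

end Norming

end NormAttaining

namespace NormAttaining

/-! ### Transfer from `f₀ ∘ T` to `T`, and the residuality argument. -/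

section Isolates

variable {𝕜 : Type*} [RCLike 𝕜] {X : Type*} [NormedAddCommGroup X] [NormedSpace 𝕜 X]
  {Y : Type*} [NormedAddCommGroup Y] [NormedSpace 𝕜 Y]

namespace IsolatesNorm

variable {T : X →L[𝕜] Y} {f₀ : StrongDual 𝕜 Y}

lemma norm_le_one (h : IsolatesNorm T f₀) : ‖f₀‖ ≤ 1 := norm_le_one_of_mem_wStarStrExp h.1

lemma norm_comp_eq [CompleteSpace Y] (hR : HasRNP 𝕜 (StrongDual 𝕜 Y)) (h : IsolatesNorm T f₀) :
    ‖f₀.comp T‖ = ‖T‖ := by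
  refine le_antisymm (norm_comp_le_of_norm_le_one h.norm_le_one T) ?_
  obtain ⟨-, -, δ, hδ, hgap⟩ := h
  refine le_of_forall_pos_le_add fun ε hε => ?_
  obtain ⟨f, hf, hfT⟩ := exists_mem_wStarStrExp_lt_norm_comp hR T (lt_min hδ hε)
  rcases hgap f hf with ⟨θ, hθ, rfl⟩ | h1
  · rw [norm_smul_comp hθ] at hfT
    linarith [min_le_right δ ε]
  · linarith [min_le_left δ ε]

lemma smul (h : IsolatesNorm T f₀) {θ : 𝕜} (hθ : ‖θ‖ = 1) : IsolatesNorm T (θ • f₀) := by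
  obtain ⟨h1, h2, δ, hδ, hgap⟩ := h
  refine ⟨smul_mem_wStarStrExp h1 hθ, smul_ne_zero (ne_zero_of_norm_eq_one hθ) h2, δ, hδ,
    fun f hf => (hgap f hf).imp_left ?_⟩
  rintro ⟨τ, hτ, rfl⟩
  refine ⟨τ * θ⁻¹, by rw [norm_mul, norm_inv, hτ, hθ, inv_one, one_mul], ?_⟩
  rw [smul_smul, mul_assoc, inv_mul_cancel₀ (ne_zero_of_norm_eq_one hθ), mul_one]

/-- Both `‖f ∘ S‖` and `‖S‖` are 1-Lipschitz in `S`, so moving by less than `δ / 4` costs at most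
half of the gap. -/
lemma eventually (h : IsolatesNorm T f₀) : ∀ᶠ S in 𝓝 T, IsolatesNorm S f₀ := by
  obtain ⟨h1, h2, δ, hδ, hgap⟩ := h
  filter_upwards [Metric.ball_mem_nhds T (show (0 : ℝ) < δ / 4 by positivity)] with S hS
  rw [Metric.mem_ball, dist_eq_norm] at hS
  refine ⟨h1, h2, δ / 2, half_pos hδ, fun f hf => (hgap f hf).imp_right fun h3 => ?_⟩
  have h4 := norm_comp_le_norm_comp_add (norm_le_one_of_mem_wStarStrExp hf) S T
  have h5 := norm_sub_norm_le T S
  rw [norm_sub_rev] at h5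
  linarith

lemma exists_eq_smul [CompleteSpace Y] (hR : HasRNP 𝕜 (StrongDual 𝕜 Y)) (h : IsolatesNorm T f₀)
    {f₁ : StrongDual 𝕜 Y} (h' : IsolatesNorm T f₁) : ∃ θ : 𝕜, ‖θ‖ = 1 ∧ f₁ = θ • f₀ := by
  have h1 := h'.norm_comp_eq hR
  obtain ⟨-, -, δ, hδ, hgap⟩ := h
  refine (hgap f₁ h'.1).resolve_right fun h2 => ?_
  linarith

/-- Where `‖T ·‖` comes close to `‖T‖`, it agrees with the modulus of `f₀ ∘ T`. -/
lemma exists_norm_apply_eq [CompleteSpace Y] (hR : HasRNP 𝕜 (StrongDual 𝕜 Y))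
    (h : IsolatesNorm T f₀) :
    ∃ δ > 0, ∀ x, ‖x‖ ≤ 1 → ‖T‖ - δ < ‖T x‖ → ‖f₀ (T x)‖ = ‖T x‖ := by
  have hf₀ := h.norm_le_one
  obtain ⟨-, -, δ, hδ, hgap⟩ := h
  refine ⟨δ / 2, half_pos hδ, fun x hx hTx => le_antisymm ?_ ?_⟩
  · exact (f₀.le_opNorm _).trans (mul_le_of_le_one_left (norm_nonneg _) hf₀)
  · refine le_of_forall_pos_le_add fun ε hε => ?_
    obtain ⟨f, hf, hfT⟩ := exists_mem_wStarStrExp_lt_re hR (T x) (lt_min (half_pos hδ) hε)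
    have h1 : ‖f (T x)‖ ≤ ‖f.comp T‖ :=
      ((f.comp T).le_opNorm x).trans (mul_le_of_le_one_right (norm_nonneg _) hx)
    have h2 := RCLike.re_le_norm (f (T x))
    rcases hgap f hf with ⟨θ, hθ, rfl⟩ | h3
    · have h4 : ‖(θ • f₀) (T x)‖ = ‖f₀ (T x)‖ := by
        rw [smul_apply, norm_smul, hθ, one_mul]
      linarith [min_le_right (δ / 2) ε]
    · linarith [min_le_left (δ / 2) ε]

lemma mem_NA [CompleteSpace Y] (hR : HasRNP 𝕜 (StrongDual 𝕜 Y)) (h : IsolatesNorm T f₀)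
    (hNA : f₀.comp T ∈ NA 𝕜 X 𝕜) : T ∈ NA 𝕜 X Y := by
  obtain ⟨x, hx, hfx⟩ := hNA
  refine ⟨x, hx, le_antisymm (by simpa [hx] using T.le_opNorm x) ?_⟩
  rw [← h.norm_comp_eq hR, ← hfx]
  exact (f₀.le_opNorm _).trans (mul_le_of_le_one_left (norm_nonneg _) h.norm_le_one)

end IsolatesNorm

section Ball

variable {g : StrongDual 𝕜 X} {x₀ : X}

lemma StronglyExposes.re_eq_norm (h : StronglyExposes 𝕜 g (Metric.closedBall (0 : X) 1) x₀) :
    RCLike.re (g x₀) = ‖g‖ := by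
  refine le_antisymm (re_apply_le_norm_of_ball g (mem_closedBall_zero_iff.1 h.1)) ?_
  refine le_of_forall_lt fun c hc => ?_
  obtain ⟨x, hx, hgx⟩ := exists_re_apply_gt hc
  exact hgx.trans_le (h.2.1 x (mem_closedBall_zero_iff.2 hx))

lemma StronglyExposes.exists_dist_lt (h : StronglyExposes 𝕜 g (Metric.closedBall (0 : X) 1) x₀)
    {ε : ℝ} (hε : 0 < ε) :
    ∃ δ > 0, ∀ x, ‖x‖ ≤ 1 → ‖g‖ - δ < RCLike.re (g x) → ‖x - x₀‖ < ε := by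
  by_contra! hcon
  choose u hu hgu hdist using fun n : ℕ => hcon (1 / ((n : ℝ) + 1)) (by positivity)
  have h1 := (tendsto_const_nhds (x := ‖g‖)).sub
    (tendsto_one_div_add_atTop_nhds_zero_nat (𝕜 := ℝ))
  rw [sub_zero] at h1
  have h2 := h.2.2 u (fun n => mem_closedBall_zero_iff.2 (hu n)) (by
    rw [h.re_eq_norm]
    exact tendsto_of_tendsto_of_tendsto_of_le_of_le h1 tendsto_const_nhds
      (fun n => (hgu n).le) (fun n => re_apply_le_norm_of_ball g (hu n)))
  have h3 := ge_of_tendsto' (tendsto_iff_norm_sub_tendsto_zero.1 h2) hdist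
  linarith

/-- Šmulyan's lemma: the norm of the dual is Fréchet differentiable at a strongly exposing
functional. -/
lemma StronglyExposes.exists_norm_add_le
    (h : StronglyExposes 𝕜 g (Metric.closedBall (0 : X) 1) x₀) {ε : ℝ} (hε : 0 < ε) :
    ∃ δ > 0, ∀ k : StrongDual 𝕜 X, ‖k‖ < δ →
      ‖g + k‖ ≤ ‖g‖ + RCLike.re (k x₀) + ε * ‖k‖ := by
  obtain ⟨δ, hδ, hd⟩ := h.exists_dist_lt hε
  refine ⟨δ / 3, by positivity, fun k hk => ?_⟩
  refine le_of_forall_pos_le_add fun τ hτ => ?_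
  -- A near-maximizer of `g + k` has `Re g x > ‖g‖ - 2‖k‖ - δ/3 > ‖g‖ - δ`, hence lies within `ε` of
  -- `x₀`.
  obtain ⟨x, hx, hgx⟩ := exists_re_apply_gt
    (sub_lt_self ‖g + k‖ (lt_min hτ (show (0 : ℝ) < δ / 3 by positivity)))
  rw [add_apply, map_add] at hgx
  have h1 := re_apply_le_norm_of_ball g hx
  have h2 := re_apply_le_norm_of_ball k hx
  have h3 : ‖g‖ - ‖k‖ ≤ ‖g + k‖ := by
    have := norm_sub_norm_le g (-k)
    rwa [sub_neg_eq_add, norm_neg] at this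
  have h4 := hd x hx (by linarith [min_le_right τ (δ / 3)])
  have h5 : RCLike.re (k (x - x₀)) ≤ ε * ‖k‖ := by
    rw [mul_comm]
    exact (re_apply_le k _).trans (by gcongr)
  rw [map_sub, map_sub] at h5
  linarith [min_le_left τ (δ / 3)]

end Ball

lemma normFrechetDifferentiableAt_of_forall {E : Type*} [NormedAddCommGroup E] [NormedSpace 𝕜 E]
    {S : E} (Φ : StrongDual 𝕜 E)
    (h : ∀ ε > 0, ∀ᶠ R in 𝓝 (0 : E), |‖S + R‖ - ‖S‖ - RCLike.re (Φ R)| ≤ ε * ‖R‖) :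
    NormFrechetDifferentiableAt 𝕜 S := by
  let _ : NormedSpace ℝ E := NormedSpace.restrictScalars ℝ 𝕜 E
  have hsmul : ∀ (r : ℝ) (R : E), r • R = ((r : ℝ) : 𝕜) • R := fun r R => rfl
  let L : E →L[ℝ] ℝ := LinearMap.mkContinuous
    { toFun := fun R => RCLike.re (Φ R)
      map_add' := fun R R' => by rw [map_add, map_add]
      map_smul' := fun r R => by
        rw [hsmul, map_smul, smul_eq_mul, RCLike.re_ofReal_mul]
        rfl } ‖Φ‖ fun R => (RCLike.abs_re_le_norm _).trans (Φ.le_opNorm R)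
  have hL : HasFDerivAt (fun z : E => ‖z‖) L S := by
    rw [hasFDerivAt_iff_isLittleO_nhds_zero, Asymptotics.isLittleO_iff]
    intro ε hε
    exact h ε hε
  exact hL.differentiableAt

namespace IsolatesNorm

variable {T : X →L[𝕜] Y} {f₀ : StrongDual 𝕜 Y}

/-- Near `T` the operator norm is `S ↦ ‖f₀ ∘ S‖`. The upper estimate is Šmulyan's lemma at `f₀ ∘ T`;
the lower one is evaluation at `x₀`. -/
lemma normFrechetDifferentiableAt [CompleteSpace Y] (hR : HasRNP 𝕜 (StrongDual 𝕜 Y))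
    (h : IsolatesNorm T f₀) (hSE : f₀.comp T ∈ SE 𝕜 X) : NormFrechetDifferentiableAt 𝕜 T := by
  obtain ⟨x₀, hx₀⟩ := hSE
  refine normFrechetDifferentiableAt_of_forall
    (f₀.comp (ContinuousLinearMap.apply 𝕜 Y x₀)) fun ε hε => ?_
  obtain ⟨δ, hδ, hd⟩ := hx₀.exists_norm_add_le hε
  have h1 : Tendsto (fun R => T + R) (𝓝 0) (𝓝 T) := by
    simpa using (continuous_const_add T).tendsto 0
  filter_upwards [h1.eventually h.eventually, Metric.ball_mem_nhds 0 hδ] with R hR1 hRδ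
  have hkR := norm_comp_le_of_norm_le_one h.norm_le_one R
  have h2 := hd (f₀.comp R) (hkR.trans_lt (mem_ball_zero_iff.1 hRδ))
  have h3 : ε * ‖f₀.comp R‖ ≤ ε * ‖R‖ := by gcongr
  have h4 := re_apply_le_norm_of_ball (f₀.comp T + f₀.comp R) (mem_closedBall_zero_iff.1 hx₀.1)
  rw [add_apply, map_add, hx₀.re_eq_norm] at h4
  rw [← ContinuousLinearMap.comp_add, hR1.norm_comp_eq hR, h.norm_comp_eq hR] at h2 h4
  change |‖T + R‖ - ‖T‖ - RCLike.re ((f₀.comp R) x₀)| ≤ _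
  rw [abs_le]
  constructor
  · have : 0 ≤ ε * ‖R‖ := by positivity
    linarith
  · linarith

/-- Eventually `‖T (u n)‖ = |f₀ (T (u n))|`, so rotating `u n` yields a maximizing sequence for `Re
(f₀ ∘ T)`. -/
lemma mem_ASE [CompleteSpace Y] (hR : HasRNP 𝕜 (StrongDual 𝕜 Y))
    (h : IsolatesNorm T f₀) (hSE : f₀.comp T ∈ SE 𝕜 X) : T ∈ ASE 𝕜 X Y := by
  obtain ⟨x₀, hx₀⟩ := hSE
  refine ⟨x₀, hx₀.1, fun u hu hlim => ?_⟩
  choose θ hθ hθu using fun n => exists_unit_mul_eq_norm (f₀ (T (u n)))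
  refine ⟨θ, hθ, hx₀.2.2 _ (fun n => ?_) ?_⟩
  · rw [mem_closedBall_zero_iff, norm_smul, hθ, one_mul]
    exact mem_closedBall_zero_iff.1 (hu n)
  · rw [hx₀.re_eq_norm, h.norm_comp_eq hR]
    obtain ⟨δ, hδ, hd⟩ := h.exists_norm_apply_eq hR
    refine hlim.congr' ?_
    filter_upwards [hlim.eventually (lt_mem_nhds (sub_lt_self ‖T‖ hδ))] with n hn
    rw [map_smul, ContinuousLinearMap.comp_apply, smul_eq_mul, hθu, RCLike.ofReal_re,
      hd _ (mem_closedBall_zero_iff.1 (hu n)) hn]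

end IsolatesNorm

/-- Operators near a given one whose adjoint isolates a functional of a prescribed transversal `R`
of the rotations, and sends it into a prescribed dense set, are dense. -/
theorem dense_isolatesNorm [Nontrivial X] [Nontrivial Y] [CompleteSpace Y]
    (hR : HasRNP 𝕜 (StrongDual 𝕜 Y)) (hD : DualDiscreteUpToRotations 𝕜 Y)
    (I : Submodule 𝕜 (X →L[𝕜] Y)) (hrank : ∀ (f : StrongDual 𝕜 X) (y : Y), f.smulRight y ∈ I)
    {P : Set (StrongDual 𝕜 Y)} (hP : ∀ f, ∃ θ : 𝕜, ‖θ‖ = 1 ∧ θ • f ∈ P)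
    {D : Set (StrongDual 𝕜 X)} (hdense : Dense D) :
    Dense {T : I | ∃ f ∈ P, IsolatesNorm (T : X →L[𝕜] Y) f ∧ f.comp (T : X →L[𝕜] Y) ∈ D} := by
  rw [Metric.dense_iff]
  intro T r hr
  obtain ⟨φ, y, f₁, hφ, hiso⟩ := exists_isolatesNorm hR hD (T : X →L[𝕜] Y) (half_pos hr)
  obtain ⟨θ, hθ, hf⟩ := hP f₁
  replace hiso := hiso.smul hθ
  set f := θ • f₁
  set S : X →L[𝕜] Y := T + φ.smulRight y with hS
  obtain ⟨v, hv⟩ : ∃ v, f v = 1 := by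
    obtain ⟨w, hw⟩ := ContinuousLinearMap.exists_ne_zero hiso.2.1
    exact ⟨(f w)⁻¹ • w, by rw [map_smul, smul_eq_mul, inv_mul_cancel₀ hw]⟩
  -- Since `f v = 1`, adding `(g - f ∘ S) ⊗ v` turns `f ∘ S` into exactly `g`; for `g ∈ D` close to
  -- `f ∘ S`, isolation survives.
  have hc : Tendsto (fun g : StrongDual 𝕜 X => S + (g - f.comp S).smulRight v) (𝓝 (f.comp S))
      (𝓝 S) := by
    have h1 : Continuous fun g : StrongDual 𝕜 X =>
        S + ContinuousLinearMap.smulRightL 𝕜 X Y (g - f.comp S) v := by fun_prop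
    have h2 := h1.tendsto (f.comp S)
    rw [sub_self, map_zero, zero_apply, add_zero] at h2
    exact h2
  have hev := hc.eventually (hiso.eventually.and (Metric.ball_mem_nhds S (half_pos hr)))
  obtain ⟨g, hgD, hg1, hg2⟩ :=
    ((mem_closure_iff_frequently.1 (hdense (f.comp S))).and_eventually hev).exists
  refine ⟨⟨S + (g - f.comp S).smulRight v, I.add_mem (I.add_mem T.2 (hrank _ _)) (hrank _ _)⟩,
    ?_, f, hf, hg1, ?_⟩
  · rw [Metric.mem_ball]
    rw [Subtype.dist_eq]
    have h3 : dist S T < r / 2 := by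
      rw [dist_eq_norm, hS, add_sub_cancel_left]
      exact hφ
    exact (dist_triangle _ S _).trans_lt (by linarith)
  · have h4 : f.comp (S + (g - f.comp S).smulRight v) = g := by
      ext x
      simp [hv]
    change f.comp (S + (g - f.comp S).smulRight v) ∈ D
    rwa [h4]

variable (𝕜) in
-- Fixing one representative per rotation orbit makes the isolated functional unique. This is needed
-- because the dense open sets witnessing residuality need not be rotation invariant.
lemma exists_transversal (E : Type*) [NormedAddCommGroup E] [NormedSpace 𝕜 E] :
    ∃ P : Set E, (∀ f, ∃ θ : 𝕜, ‖θ‖ = 1 ∧ θ • f ∈ P) ∧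
      ∀ f ∈ P, ∀ θ : 𝕜, ‖θ‖ = 1 → θ • f ∈ P → θ • f = f := by
  let s : Setoid E :=
    { r := fun f g => ∃ θ : 𝕜, ‖θ‖ = 1 ∧ θ • f = g
      iseqv :=
        { refl := fun f => ⟨1, norm_one, one_smul _ _⟩
          symm := by
            rintro f _ ⟨θ, hθ, rfl⟩
            exact ⟨θ⁻¹, by rw [norm_inv, hθ, inv_one],
              inv_smul_smul₀ (ne_zero_of_norm_eq_one hθ) _⟩
          trans := by
            rintro f _ _ ⟨θ, hθ, rfl⟩ ⟨τ, hτ, rfl⟩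
            exact ⟨τ * θ, by rw [norm_mul, hθ, hτ, one_mul], mul_smul _ _ _⟩ } }
  refine ⟨Set.range fun q : Quotient s => q.out, fun f => ?_, ?_⟩
  · obtain ⟨θ, hθ, h⟩ := s.symm (Quotient.mk_out (s := s) f)
    exact ⟨θ, hθ, Quotient.mk s f, h.symm⟩
  · rintro _ ⟨q, rfl⟩ θ hθ ⟨q', hq'⟩
    change q'.out = θ • q.out at hq'
    have h1 : q = q' := by
      rw [← q.out_eq, ← q'.out_eq]
      exact Quotient.sound ⟨θ, hθ, hq'.symm⟩
    subst h1
    exact hq'.symm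

theorem residual_NA [Nontrivial X] [Nontrivial Y] [CompleteSpace X] [CompleteSpace Y]
    (hR : HasRNP 𝕜 (StrongDual 𝕜 Y)) (hD : DualDiscreteUpToRotations 𝕜 Y)
    (I : Submodule 𝕜 (X →L[𝕜] Y)) (hrank : ∀ (f : StrongDual 𝕜 X) (y : Y), f.smulRight y ∈ I)
    (hNA : NA 𝕜 X 𝕜 ∈ residual (StrongDual 𝕜 X)) :
    {T : I | (T : X →L[𝕜] Y) ∈ NA 𝕜 X Y} ∈ residual I := by
  obtain ⟨𝒪, hopen, hdense, hcount, hsub⟩ := mem_residual_iff.1 hNA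
  obtain ⟨P, hP, hPu⟩ := exists_transversal 𝕜 (StrongDual 𝕜 Y)
  let M : Set (StrongDual 𝕜 X) → Set I := fun O =>
    {T : I | ∃ f ∈ P, IsolatesNorm (T : X →L[𝕜] Y) f ∧ f.comp (T : X →L[𝕜] Y) ∈ O}
  have hMopen : ∀ O, IsOpen O → IsOpen (M O) := by
    intro O hO
    rw [isOpen_iff_mem_nhds]
    rintro T ⟨f, hf, hiso, hTO⟩
    have h1 : Tendsto (fun S : I => (S : X →L[𝕜] Y)) (𝓝 T) (𝓝 (T : X →L[𝕜] Y)) :=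
      continuous_subtype_val.tendsto T
    have h2 : Continuous fun S : X →L[𝕜] Y => f.comp S := by fun_prop
    filter_upwards [h1.eventually hiso.eventually,
      ((h2.tendsto _).comp h1).eventually (hO.mem_nhds hTO)] with S hS hSO
    exact ⟨f, hf, hS, hSO⟩
  have hMdense : ∀ O, Dense O → Dense (M O) := fun O hO => dense_isolatesNorm hR hD I hrank hP hO
  -- `M Set.univ` supplies an isolated functional even when the family `𝒪` is empty.
  refine mem_residual_iff.2 ⟨insert (M Set.univ) (M '' 𝒪), ?_, ?_, (hcount.image M).insert _, ?_⟩
  · rintro _ (rfl | ⟨O, hO, rfl⟩)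
    exacts [hMopen _ isOpen_univ, hMopen O (hopen O hO)]
  · rintro _ (rfl | ⟨O, hO, rfl⟩)
    exacts [hMdense _ dense_univ, hMdense O (hdense O hO)]
  · intro T hT
    rw [Set.sInter_insert, Set.sInter_image] at hT
    obtain ⟨⟨f, hf, hiso, -⟩, hT⟩ := hT
    refine hiso.mem_NA hR (hsub ?_)
    rw [Set.mem_sInter]
    intro O hO
    obtain ⟨f', hf', hiso', hTO⟩ := Set.mem_iInter₂.1 hT O hO
    obtain ⟨θ, hθ, rfl⟩ := hiso.exists_eq_smul hR hiso'
    rwa [hPu f hf θ hθ hf'] at hTO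

end Isolates

end NormAttaining

namespace NormAttaining

/-! ### Preduals of `ℓ₁(Γ)`. -/

section EllOne

variable {𝕜 : Type*} [RCLike 𝕜]

lemma StronglyExposes.eq_of_re_eq {E : Type*} [NormedAddCommGroup E] [NormedSpace 𝕜 E]
    {f : StrongDual 𝕜 E} {C : Set E} {x₀ x : E} (h : StronglyExposes 𝕜 f C x₀) (hx : x ∈ C)
    (hfx : RCLike.re (f x₀) ≤ RCLike.re (f x)) : x = x₀ := by
  have h1 : RCLike.re (f x) = RCLike.re (f x₀) := le_antisymm (h.2.1 x hx) hfx
  have h2 := h.2.2 (fun _ => x) (fun _ => hx) (by rw [h1]; exact tendsto_const_nhds)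
  exact tendsto_nhds_unique tendsto_const_nhds h2

lemma wStarStrExp_subset_strExp {E : Type*} [NormedAddCommGroup E] [NormedSpace 𝕜 E]
    (C : Set (StrongDual 𝕜 E)) : wStarStrExp 𝕜 C ⊆ strExp 𝕜 C := by
  rintro f ⟨x, hx⟩
  exact ⟨_, hx⟩

section Isometry

variable {E F : Type*} [NormedAddCommGroup E] [NormedSpace 𝕜 E] [NormedAddCommGroup F]
  [NormedSpace 𝕜 F]

lemma map_mem_strExp_closedBall (e : E ≃ₗᵢ[𝕜] F) {x : E}
    (hx : x ∈ strExp 𝕜 (Metric.closedBall (0 : E) 1)) :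
    e x ∈ strExp 𝕜 (Metric.closedBall (0 : F) 1) := by
  obtain ⟨f, h1, h2, h3⟩ := hx
  have hmem : ∀ y ∈ Metric.closedBall (0 : F) 1, e.symm y ∈ Metric.closedBall (0 : E) 1 := by
    intro y hy
    rw [mem_closedBall_zero_iff] at hy ⊢
    rwa [e.symm.norm_map]
  have heq : ∀ y, f.comp (e.symm.toContinuousLinearEquiv : F →L[𝕜] E) y = f (e.symm y) :=
    fun _ => rfl
  refine ⟨f.comp (e.symm.toContinuousLinearEquiv : F →L[𝕜] E), ?_, fun y hy => ?_,
    fun u hu hlim => ?_⟩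
  · rw [mem_closedBall_zero_iff] at h1 ⊢
    rwa [e.norm_map]
  · rw [heq, heq, e.symm_apply_apply]
    exact h2 _ (hmem y hy)
  · simp only [heq, e.symm_apply_apply] at hlim
    have h4 := (e.continuous.tendsto x).comp (h3 _ (fun n => hmem _ (hu n)) hlim)
    exact h4.congr fun n => e.apply_symm_apply _

lemma HasRNP.of_linearIsometryEquiv (e : E ≃ₗᵢ[𝕜] F) (h : HasRNP 𝕜 F) : HasRNP 𝕜 E := by
  intro C hC hb ε hε
  have hb' : Bornology.IsBounded (e '' C) := e.lipschitz.isBounded_image hb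
  obtain ⟨f, α, hα, hd⟩ := h (e '' C) (hC.image e) hb' ε hε
  refine ⟨f.comp (e.toContinuousLinearEquiv : E →L[𝕜] F), α, hα, ?_⟩
  have h1 : slice 𝕜 (e '' C) f α =
      e '' slice 𝕜 C (f.comp (e.toContinuousLinearEquiv : E →L[𝕜] F)) α := by
    ext y
    constructor
    · rintro ⟨⟨x, hx, rfl⟩, hy⟩
      refine ⟨x, ⟨hx, ?_⟩, rfl⟩
      rwa [Set.image_image] at hy
    · rintro ⟨x, ⟨hx, hy⟩, rfl⟩
      refine ⟨⟨x, hx, rfl⟩, ?_⟩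
      rwa [Set.image_image]
  rwa [h1, e.isometry.diam_image] at hd

end Isometry

variable {Γ : Type*}

lemma hasSum_norm_lp_one (z : lp (fun _ : Γ => 𝕜) 1) : HasSum (fun γ => ‖z γ‖) ‖z‖ := by
  have := lp.hasSum_norm (p := 1) (by simp) z
  simpa using this

lemma norm_sub_single_lp_one [DecidableEq Γ] (z : lp (fun _ : Γ => 𝕜) 1) (γ : Γ) :
    ‖z - lp.single 1 γ (z γ)‖ = ‖z‖ - ‖z γ‖ := by
  have := lp.norm_sub_norm_compl_sub_single (p := 1) (by simp) z {γ}
  simp only [ENNReal.toReal_one, Real.rpow_one, Finset.sum_singleton] at this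
  linarith

lemma norm_single_lp_one [DecidableEq Γ] (γ : Γ) (c : 𝕜) :
    ‖(lp.single 1 γ c : lp (fun _ : Γ => 𝕜) 1)‖ = ‖c‖ :=
  lp.norm_single (E := fun _ : Γ => 𝕜) (p := 1) one_pos γ c

/-- The strongly exposed points of the unit ball of `ℓ₁` are the rotated unit vectors. -/
lemma eq_single_of_mem_strExp_lp_one [DecidableEq Γ] {z : lp (fun _ : Γ => 𝕜) 1}
    (hz : z ∈ strExp 𝕜 (Metric.closedBall (0 : lp (fun _ : Γ => 𝕜) 1) 1)) :
    (∀ w : lp (fun _ : Γ => 𝕜) 1, ‖w‖ ≤ 1 → w = z) ∨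
      ∃ (γ : Γ) (c : 𝕜), ‖c‖ = 1 ∧ z = lp.single 1 γ c := by
  obtain ⟨f, hf⟩ := hz
  have hnorm := hf.re_eq_norm
  -- If `0` is strongly exposed then `f = 0`, and the ball is a single point.
  by_cases hz0 : z = 0
  · left
    intro w hw
    refine hf.eq_of_re_eq (mem_closedBall_zero_iff.2 hw) ?_
    rw [hz0, map_zero, map_zero] at hnorm
    rw [norm_eq_zero.1 hnorm.symm, zero_apply, zero_apply]
  · right
    obtain ⟨γ, hγ⟩ : ∃ γ, z γ ≠ 0 := by
      by_contra! hcon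
      exact hz0 (lp.ext (funext hcon))
    have hpos : 0 < ‖z γ‖ := norm_pos_iff.2 hγ
    have hinv : ‖((‖z γ‖⁻¹ : ℝ) : 𝕜) * z γ‖ = 1 := by
      rw [norm_mul, RCLike.norm_ofReal, abs_of_pos (inv_pos.2 hpos), inv_mul_cancel₀ hpos.ne']
    refine ⟨γ, ((‖z γ‖⁻¹ : ℝ) : 𝕜) * z γ, hinv, (hf.eq_of_re_eq ?_ ?_).symm⟩
    · rw [mem_closedBall_zero_iff, norm_single_lp_one, hinv]
    · have h1 : (lp.single 1 γ (((‖z γ‖⁻¹ : ℝ) : 𝕜) * z γ) : lp (fun _ : Γ => 𝕜) 1) =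
          ((‖z γ‖⁻¹ : ℝ) : 𝕜) • lp.single 1 γ (z γ) := by
        rw [← smul_eq_mul, lp.single_smul]
      rw [h1, map_smul, smul_eq_mul, RCLike.re_ofReal_mul, hnorm, inv_mul_eq_div,
        le_div_iff₀ hpos]
      -- The part of `z` off `γ` contributes at most `‖f‖ (‖z‖ - ‖z γ‖)`, so the `γ` part already
      -- attains `‖f‖ ‖z γ‖`.
      have h2 := re_apply_le f (z - lp.single 1 γ (z γ))
      rw [norm_sub_single_lp_one, map_sub, map_sub, hnorm] at h2
      have h3 : ‖f‖ * ‖z‖ ≤ ‖f‖ :=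
        mul_le_of_le_one_right (norm_nonneg _) (mem_closedBall_zero_iff.1 hf.1)
      rw [mul_sub] at h2
      linarith

/-- Rotated unit vectors with different indices differ by modulus 1 in one coordinate, hence lie at
distance at least 1. -/
lemma exists_smul_eq_of_mem_strExp_lp_one {z w : lp (fun _ : Γ => 𝕜) 1}
    (hz : z ∈ strExp 𝕜 (Metric.closedBall (0 : lp (fun _ : Γ => 𝕜) 1) 1))
    (hw : w ∈ strExp 𝕜 (Metric.closedBall (0 : lp (fun _ : Γ => 𝕜) 1) 1)) (hd : dist z w < 1) :
    ∃ θ : 𝕜, ‖θ‖ = 1 ∧ z = θ • w := by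
  classical
  have hz1 : ‖z‖ ≤ 1 := by obtain ⟨f, hf, -⟩ := hz; exact mem_closedBall_zero_iff.1 hf
  rcases eq_single_of_mem_strExp_lp_one hw with h | ⟨γ, c, hc, rfl⟩
  · exact ⟨1, norm_one, by rw [one_smul]; exact h z hz1⟩
  rcases eq_single_of_mem_strExp_lp_one hz with h | ⟨γ', c', hc', rfl⟩
  · exact ⟨1, norm_one, by
      rw [one_smul]; exact (h _ (by rw [norm_single_lp_one, hc])).symm⟩
  by_cases hγ : γ' = γ
  · subst hγ
    refine ⟨c' * c⁻¹, by rw [norm_mul, norm_inv, hc, hc', inv_one, one_mul], ?_⟩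
    rw [← lp.single_smul, smul_eq_mul, mul_assoc, inv_mul_cancel₀ (ne_zero_of_norm_eq_one hc),
      mul_one]
  · exfalso
    have h1 := lp.norm_apply_le_norm (p := 1) one_ne_zero
      ((lp.single 1 γ' c' : lp (fun _ : Γ => 𝕜) 1) - lp.single 1 γ c) γ'
    rw [lp.coeFn_sub, Pi.sub_apply, lp.single_apply_self, lp.single_apply_ne _ _ _ hγ, sub_zero,
      hc', ← dist_eq_norm] at h1
    linarith

theorem dualDiscreteUpToRotations_of_lp_one {Y : Type*} [NormedAddCommGroup Y] [NormedSpace 𝕜 Y]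
    (e : StrongDual 𝕜 Y ≃ₗᵢ[𝕜] lp (fun _ : Γ => 𝕜) 1) : DualDiscreteUpToRotations 𝕜 Y := by
  intro u y₀ hu hy₀ hlim
  obtain ⟨n₀, hn₀⟩ := Metric.tendsto_atTop.1 hlim 1 one_pos
  have h1 : ∀ n, ∃ θ : 𝕜, ‖θ‖ = 1 ∧ (n ≥ n₀ → u n = θ • y₀) := by
    intro n
    by_cases hn : n ≥ n₀
    · obtain ⟨θ, hθ, h⟩ := exists_smul_eq_of_mem_strExp_lp_one
        (map_mem_strExp_closedBall e (wStarStrExp_subset_strExp _ (hu n)))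
        (map_mem_strExp_closedBall e hy₀) (by rw [e.dist_map]; exact hn₀ n hn)
      refine ⟨θ, hθ, fun _ => e.injective ?_⟩
      rw [h, map_smul]
    · exact ⟨1, norm_one, fun h => absurd h hn⟩
  choose θ hθ h using h1
  exact ⟨n₀, θ, hθ, h⟩

/-- Off `F`, the difference is bounded by the sum of the two tails. -/
lemma norm_sub_le_of_finset_lp_one (z w : lp (fun _ : Γ => 𝕜) 1) (F : Finset Γ) :
    ‖z - w‖ ≤ ∑ γ ∈ F, ‖z γ - w γ‖ + (‖z‖ - ∑ γ ∈ F, ‖z γ‖) + (‖w‖ - ∑ γ ∈ F, ‖w γ‖) := by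
  have h1 := ((hasSum_norm_lp_one z).add (hasSum_norm_lp_one w)).sub (hasSum_norm_lp_one (z - w))
  have h2 := sum_le_hasSum F (fun γ _ => sub_nonneg.2 (norm_sub_le (z γ) (w γ))) h1
  rw [Finset.sum_sub_distrib, Finset.sum_add_distrib] at h2
  have h3 : ∑ γ ∈ F, ‖(z - w) γ‖ = ∑ γ ∈ F, ‖z γ - w γ‖ := rfl
  linarith

/-- With `s` the supremum of the norm on `C`, points of `C` where this finite linear form is close
to `s` carry little mass outside `F`. -/
lemma exists_linear_almost_norm_lp_one {C : Set (lp (fun _ : Γ => 𝕜) 1)} (hC : C.Nonempty)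
    {M η : ℝ} (hM : ∀ z ∈ C, ‖z‖ ≤ M) (hη : 0 < η) :
    ∃ (F : Finset Γ) (σ : Γ → 𝕜) (s : ℝ), (∀ γ, ‖σ γ‖ = 1) ∧ (∀ z ∈ C, ‖z‖ ≤ s) ∧
      ∃ z ∈ C, s - η < ∑ γ ∈ F, RCLike.re (σ γ * z γ) := by
  have hbdd : BddAbove ((fun z : lp (fun _ : Γ => 𝕜) 1 => ‖z‖) '' C) :=
    ⟨M, by rintro _ ⟨z, hz, rfl⟩; exact hM z hz⟩
  obtain ⟨_, ⟨z, hz, rfl⟩, hlt⟩ := exists_lt_of_lt_csSup (hC.image fun z => ‖z‖)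
    (sub_lt_self (sSup ((fun z : lp (fun _ : Γ => 𝕜) 1 => ‖z‖) '' C)) hη)
  obtain ⟨F, hF⟩ := ((hasSum_norm_lp_one z).eventually (lt_mem_nhds hlt)).exists
  choose σ hσ hσz using fun γ => exists_unit_mul_eq_norm (z γ)
  refine ⟨F, σ, _, hσ, fun w hw => le_csSup hbdd ⟨w, hw, rfl⟩, z, hz, ?_⟩
  simpa only [hσz, RCLike.ofReal_re] using hF

lemma normSq_sub_identity (a b : 𝕜) :
    ‖a‖ ^ 2 - ‖b‖ ^ 2 - ‖a - b‖ ^ 2 =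
      2 * (RCLike.re ((starRingEnd 𝕜) b * a) - RCLike.re ((starRingEnd 𝕜) b * b)) := by
  simp only [← RCLike.normSq_eq_def', RCLike.normSq_apply, RCLike.mul_re, RCLike.conj_re,
    RCLike.conj_im, map_sub]
  ring

/-- Let `z₀` nearly maximize `q = f₁ + τ N` on `C`. Linearizing `q` at `z₀` gives `g` with `Re g z -
Re g z₀ = q z - q z₀ - τ N (z - z₀)`. In a thin slice of `g`, strict convexity of `N` controls the
coordinates in `F`, while near-maximality of `q` makes the tails small. -/
theorem hasRNP_lp_one : HasRNP 𝕜 (lp (fun _ : Γ => 𝕜) 1) := by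
  intro C hC hb ε hε
  obtain ⟨M, hMpos, hM⟩ := hb.exists_pos_norm_le
  obtain ⟨η, hη, hηε⟩ : ∃ η : ℝ, 0 < η ∧ 22 * η < ε := ⟨ε / 23, by positivity, by linarith⟩
  obtain ⟨F, σ, s, hσ, hs, z₁, hz₁, hz₁F⟩ := exists_linear_almost_norm_lp_one hC hM hη
  obtain ⟨τ, hτ, hτM⟩ : ∃ τ : ℝ, 0 < τ ∧ τ * M ^ 2 ≤ η :=
    ⟨η / M ^ 2, by positivity, by rw [div_mul_cancel₀ _ (by positivity)]⟩
  let N : lp (fun _ : Γ => 𝕜) 1 → ℝ := fun z => ∑ γ ∈ F, ‖z γ‖ ^ 2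
  let f₁ : lp (fun _ : Γ => 𝕜) 1 → ℝ := fun z => ∑ γ ∈ F, RCLike.re (σ γ * z γ)
  let q : lp (fun _ : Γ => 𝕜) 1 → ℝ := fun z => f₁ z + τ * N z
  have hF : ∀ z : lp (fun _ : Γ => 𝕜) 1, ∑ γ ∈ F, ‖z γ‖ ≤ ‖z‖ := fun z =>
    sum_le_hasSum F (fun _ _ => norm_nonneg _) (hasSum_norm_lp_one z)
  have hf₁ : ∀ z, f₁ z ≤ ∑ γ ∈ F, ‖z γ‖ := fun z => Finset.sum_le_sum fun γ _ => by
    have := RCLike.re_le_norm (σ γ * z γ)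
    rwa [norm_mul, hσ, one_mul] at this
  have hN0 : ∀ z, 0 ≤ τ * N z := fun z => by positivity
  have hN : ∀ z ∈ C, τ * N z ≤ η := by
    intro z hz
    refine le_trans ?_ hτM
    gcongr
    calc N z ≤ ∑ γ ∈ F, ‖z‖ * ‖z γ‖ := Finset.sum_le_sum fun γ _ => by
          rw [sq]
          gcongr
          exact lp.norm_apply_le_norm one_ne_zero z γ
      _ = ‖z‖ * ∑ γ ∈ F, ‖z γ‖ := (Finset.mul_sum _ _ _).symm
      _ ≤ M * M := by gcongr; exacts [hM z hz, (hF z).trans (hM z hz)]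
      _ = M ^ 2 := (sq M).symm
  -- The slice depth and the defect of `z₀` give `τ N (z - z₀) < 2κ`; Cauchy–Schwarz over `F` then
  -- bounds the `ℓ₁` distance on `F` by `η`.
  obtain ⟨κ, hκ, hκη, hκF⟩ : ∃ κ : ℝ, 0 < κ ∧ κ ≤ η ∧ (F.card : ℝ) * (2 * κ) ≤ τ * η ^ 2 := by
    refine ⟨min η (τ * η ^ 2 / (2 * (F.card + 1))), by positivity, min_le_left _ _, ?_⟩
    calc (F.card : ℝ) * (2 * min η (τ * η ^ 2 / (2 * (F.card + 1))))
        ≤ (F.card + 1) * (2 * (τ * η ^ 2 / (2 * (F.card + 1)))) := by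
          gcongr
          · linarith
          · exact min_le_right _ _
      _ = τ * η ^ 2 := by field_simp
  have hqb : BddAbove (q '' C) := by
    refine ⟨s + η, ?_⟩
    rintro _ ⟨z, hz, rfl⟩
    exact add_le_add ((hf₁ z).trans ((hF z).trans (hs z hz))) (hN z hz)
  obtain ⟨_, ⟨z₀, hz₀, rfl⟩, hq₀⟩ := exists_lt_of_lt_csSup (hC.image q)
    (sub_lt_self (sSup (q '' C)) hκ)
  have hq : ∀ z ∈ C, q z < q z₀ + κ := fun z hz => by
    have := le_csSup hqb ⟨z, hz, rfl⟩
    linarith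
  let g : StrongDual 𝕜 (lp (fun _ : Γ => 𝕜) 1) := ∑ γ ∈ F,
    (σ γ + ((2 * τ : ℝ) : 𝕜) * (starRingEnd 𝕜) (z₀ γ)) • lp.evalCLM 𝕜 (fun _ : Γ => 𝕜) 1 γ
  have hg : ∀ z, RCLike.re (g z) =
      f₁ z + 2 * τ * ∑ γ ∈ F, RCLike.re ((starRingEnd 𝕜) (z₀ γ) * z γ) := by
    intro z
    have h1 : g z = ∑ γ ∈ F, (σ γ + ((2 * τ : ℝ) : 𝕜) * (starRingEnd 𝕜) (z₀ γ)) * z γ := by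
      simp only [g, sum_apply, smul_apply, smul_eq_mul]
      rfl
    rw [h1, map_sum, Finset.mul_sum, ← Finset.sum_add_distrib]
    refine Finset.sum_congr rfl fun γ _ => ?_
    rw [add_mul, map_add, mul_assoc, RCLike.re_ofReal_mul]
  have hid : ∀ z, RCLike.re (g z) - RCLike.re (g z₀) = q z - q z₀ - τ * N (z - z₀) := by
    intro z
    have h1 : N z - N z₀ - N (z - z₀) =
        2 * (∑ γ ∈ F, RCLike.re ((starRingEnd 𝕜) (z₀ γ) * z γ) -
          ∑ γ ∈ F, RCLike.re ((starRingEnd 𝕜) (z₀ γ) * z₀ γ)) := by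
      simp only [N, ← Finset.sum_sub_distrib, Finset.mul_sum]
      exact Finset.sum_congr rfl fun γ _ => normSq_sub_identity (z γ) (z₀ γ)
    rw [hg, hg]
    simp only [q]
    linear_combination (-τ) * h1
  have hgb : BddAbove ((fun z => RCLike.re (g z)) '' C) := by
    refine ⟨‖g‖ * M, ?_⟩
    rintro _ ⟨z, hz, rfl⟩
    exact (re_apply_le g z).trans (by gcongr; exact hM z hz)
  have htail : ∀ z ∈ C, q z₀ - κ < q z → ‖z‖ - ∑ γ ∈ F, ‖z γ‖ ≤ 5 * η := by
    intro z hz hqz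
    have h1 : q z ≤ f₁ z + η := add_le_add_right (hN z hz) _
    have h2 : f₁ z₁ ≤ q z₁ := le_add_of_nonneg_right (hN0 z₁)
    have h3 : s - η < f₁ z₁ := hz₁F
    linarith [hq z₁ hz₁, hs z hz, hf₁ z]
  have hmain : ∀ z ∈ slice 𝕜 C g κ, ‖z - z₀‖ ≤ 11 * η := by
    rintro z ⟨hz, hgz⟩
    have h1 := le_csSup hgb ⟨z₀, hz₀, rfl⟩
    have h2 := hid z
    have h3 := hq z hz
    have h4 : τ * N (z - z₀) < 2 * κ := by
      simp only at h1
      linarith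
    have h5 : q z₀ - κ < q z := by
      have := hN0 (z - z₀)
      simp only at h1
      linarith
    have h6 : ∑ γ ∈ F, ‖z γ - z₀ γ‖ ≤ η := by
      refine (abs_le_of_sq_le_sq' ?_ hη.le).2
      refine le_of_mul_le_mul_left (a := τ) ?_ hτ
      calc τ * (∑ γ ∈ F, ‖z γ - z₀ γ‖) ^ 2 ≤ τ * (F.card * N (z - z₀)) := by
            gcongr
            exact sq_sum_le_card_mul_sum_sq
        _ = F.card * (τ * N (z - z₀)) := by ring
        _ ≤ F.card * (2 * κ) := by gcongr
        _ ≤ τ * η ^ 2 := hκF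
    have h7 := norm_sub_le_of_finset_lp_one z z₀ F
    have h8 := htail z hz h5
    have h9 := htail z₀ hz₀ (by linarith)
    -- The radius is `11η`: `η` on `F` and `5η` for each tail.
    linarith
  refine ⟨g, κ, hκ, (Metric.diam_le_of_forall_dist_le (by positivity) fun z hz w hw => ?_).trans_lt
    hηε⟩
  have h1 := dist_triangle_right z w z₀
  rw [dist_eq_norm z z₀, dist_eq_norm w z₀] at h1
  linarith [hmain z hz, hmain w hw]

end EllOne

end NormAttaining

/-! ### Assembly and degenerate spaces. -/

theorem mainTheorem9 {𝕜 : Type*} [RCLike 𝕜]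
    (X : Type*) [NormedAddCommGroup X] [NormedSpace 𝕜 X] [CompleteSpace X]
    (Y : Type*) [NormedAddCommGroup Y] [NormedSpace 𝕜 Y] [CompleteSpace Y]
    (I : Submodule 𝕜 (X →L[𝕜] Y)) (hI : IsClosed (I : Set (X →L[𝕜] Y)))
    (hrank : ∀ (f : StrongDual 𝕜 X) (y : Y), f.smulRight y ∈ I) :
    (NormAttaining.HasRNP 𝕜 (StrongDual 𝕜 Y) →
      NormAttaining.DualDiscreteUpToRotations 𝕜 Y →
      (NormAttaining.NA 𝕜 X 𝕜 ∈ residual (StrongDual 𝕜 X) →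
        {T : I | (T : X →L[𝕜] Y) ∈ NormAttaining.NA 𝕜 X Y} ∈ residual I) ∧
      (Dense (NormAttaining.SE 𝕜 X) →
        Dense {T : I | NormAttaining.NormFrechetDifferentiableAt 𝕜 (T : X →L[𝕜] Y)} ∧
        (Nontrivial Y → Dense {T : I | (T : X →L[𝕜] Y) ∈ NormAttaining.ASE 𝕜 X Y}))) ∧
    (∀ Γ : Type*, Nonempty (StrongDual 𝕜 Y ≃ₗᵢ[𝕜] lp (fun _ : Γ => 𝕜) 1) →
      NormAttaining.HasRNP 𝕜 (StrongDual 𝕜 Y) ∧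
      NormAttaining.DualDiscreteUpToRotations 𝕜 Y) := by
  refine ⟨fun hR hD => ⟨fun hNA => ?_, fun hSE => ?_⟩, ?_⟩
  -- By Baire a residual set is nonempty, which provides a unit vector of `X`.
  · obtain ⟨f, x, hx, -⟩ := (dense_of_mem_residual hNA).nonempty
    have : Nontrivial X := ⟨x, 0, fun h => by simp [h] at hx⟩
    rcases subsingleton_or_nontrivial Y with hY | hY
    · refine univ_mem' fun T => ⟨x, hx, ?_⟩
      rw [Subsingleton.elim (T : X →L[𝕜] Y) 0]
      simp
    · exact NormAttaining.residual_NA hR hD I hrank hNA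
  · rcases subsingleton_or_nontrivial X with hX | hX
    · have hzero : ∀ T : X →L[𝕜] Y, T = 0 := fun T => by
        ext x
        rw [Subsingleton.elim x 0, map_zero, zero_apply]
      refine ⟨?_, fun _ => ?_⟩
      · refine dense_univ.mono fun T _ =>
          NormAttaining.normFrechetDifferentiableAt_of_forall 0 fun ε hε =>
            Filter.Eventually.of_forall fun R => ?_
        simp [hzero]
      · refine dense_univ.mono fun T _ => ⟨0, by simp, fun u _ _ => ⟨1, by simp, ?_⟩⟩
        exact tendsto_const_nhds.congr fun n => Subsingleton.elim _ _
    rcases subsingleton_or_nontrivial Y with hY | hY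
    · refine ⟨?_, fun h => absurd h (not_nontrivial Y)⟩
      refine dense_univ.mono fun T _ =>
        NormAttaining.normFrechetDifferentiableAt_of_forall 0 fun ε hε =>
          Filter.Eventually.of_forall fun R => ?_
      simp [Subsingleton.elim R 0]
    -- Only one dense set is involved, so no choice of rotation is needed.
    have hd := NormAttaining.dense_isolatesNorm hR hD I hrank (P := Set.univ)
      (fun f => ⟨1, norm_one, Set.mem_univ _⟩) hSE
    refine ⟨hd.mono ?_, fun _ => hd.mono ?_⟩
    · rintro T ⟨f, -, hf, hfT⟩
      exact hf.normFrechetDifferentiableAt hR hfT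
    · rintro T ⟨f, -, hf, hfT⟩
      exact hf.mem_ASE hR hfT
  · rintro Γ ⟨e⟩
    exact ⟨NormAttaining.hasRNP_lp_one.of_linearIsometryEquiv e,
      NormAttaining.dualDiscreteUpToRotations_of_lp_one e⟩
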